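/- **The Tiling Lemma.** Let $X$ be a surface (a Hausdorff topological $2$-manifold without boundary, for example the Euclidean plane, the sphere or the hyperbolic plane). A *tessellation* of $X$ is a locally finite family of closed topological disks (the *tiles*) that cover $X$ and have pairwise disjoint interiors, together with a set of *vertices*, which are points on the boundaries of tiles, such that every point where at least three tiles meet is a vertex (vertices where only two tiles meet are allowed), and such that the boundary of each tile contains finitely many, and at least one, vertices. If exactly $q$ tiles of the tessellation meet at a vertex $x$, then $q = q(x)$ is the *valence* of $x$, and each of these tiles has *valence angle* $2\pi/q$ at $x$. The *imbalance* of a tile $t$ with $n_t$ vertices on its boundary is $K_t=\Sigma_t-(n_t-2)\pi$, where $\Sigma_t$ is the sum of its valence angles at these $n_t$ vertices. A *configuration* $C$ is a finite set of tiles whose union is a closed topological disk. At a vertex $x$ on the boundary of this disk at which $k$ tiles of $C$ meet, the valence angle of $C$ is the sum $2\pi k/q(x)$ of the valence angles of these tiles. If $C$ has $n$ vertices on its boundary, and $\Sigma$ is the sum of its valence angles at them, then the imbalance of $C$ is $K=\Sigma-(n-2)\pi$. For every configuration $C$ of every such tessellation, $$K=\sum_{t\in C}K_t ,\qquad\text{and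 consequently}\qquad |K-2\pi|<\pi n .$$ -/

import Mathlib

open Real

noncomputable section

/-- A subset of a topological space is a (closed) topological disk if, with the subspace topology,
it is homeomorphic to the closed unit disk. -/
def IsTopologicalDisk {X : Type*} [TopologicalSpace X] (s : Set X) : Prop :=
  Nonempty (s ≃ₜ Metric.closedBall (0 : ℂ) 1)

/-- A tessellation of a space `X` (in the theorem, a surface) by topological disks: a locally finite
cover by disks with pairwise disjoint interiors, together with its vertices. Every point where three
or more tiles meet is a vertex. (Further vertices, where just two tiles meet, are allowed.) -/
structure Tessellation (X : Type*) [TopologicalSpace X] (ι : Type*) where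
  /-- The tiles. -/
  tile : ι → Set X
  /-- The set of vertices. -/
  vertex : Set X
  isDisk : ∀ i, IsTopologicalDisk (tile i)
  covers : ⋃ i, tile i = Set.univ
  disjoint_interior : Pairwise fun i j => Disjoint (interior (tile i)) (interior (tile j))
  locallyFinite : LocallyFinite tile
  /-- Vertices lie on the boundaries of tiles. -/
  vertex_subset : vertex ⊆ ⋃ i, frontier (tile i)
  /-- A point where three different tiles meet is a vertex. -/
  mem_vertex : ∀ i j k, i ≠ j → i ≠ k → j ≠ k → ∀ x, x ∈ tile i → x ∈ tile j → x ∈ tile k →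
    x ∈ vertex
  /-- Each tile is a polygon: there are finitely many vertices on its boundary, and at least one. -/
  finite_vertex : ∀ i, (vertex ∩ frontier (tile i)).Finite
  nonempty_vertex : ∀ i, (vertex ∩ frontier (tile i)).Nonempty

namespace Tessellation

variable {X : Type*} [TopologicalSpace X] {ι : Type*} (T : Tessellation X ι)

/-- The valence of a point `x`: the number of tiles of the whole tessellation that meet at `x`. -/
def valence (x : X) : ℕ := {i | x ∈ T.tile i}.ncard

/-- The valence angle `2π / q` of each of the `q` tiles that meet at `x`. -/
def valenceAngle (x : X) : ℝ := 2 * π / T.valence x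

/-- The vertices of a tile. -/
def tileVertices (i : ι) : Set X := T.vertex ∩ frontier (T.tile i)

/-- The imbalance `Σ - (n - 2)π` of a tile with `n` vertices, `Σ` the sum of its valence angles. -/
def tileImbalance (i : ι) : ℝ :=
  (∑ᶠ x ∈ T.tileVertices i, T.valenceAngle x) - ((T.tileVertices i).ncard - 2 : ℝ) * π

/-- The region covered by a collection of tiles. -/
def region (C : Finset ι) : Set X := ⋃ i ∈ C, T.tile i

/-- A configuration: a finite collection of tiles whose union is a topological disk. -/
def IsConfiguration (C : Finset ι) : Prop := IsTopologicalDisk (T.region C)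

/-- The vertices on the boundary of a configuration. -/
def boundaryVertices (C : Finset ι) : Set X := T.vertex ∩ frontier (T.region C)

open Classical in
/-- The valence angle of a configuration at `x`: the part of the full angle `2π` around `x` that is
taken up by the tiles of the configuration, each tile at `x` having its valence angle. -/
def configurationAngle (C : Finset ι) (x : X) : ℝ :=
  ∑ i ∈ C with x ∈ T.tile i, T.valenceAngle x

/-- The imbalance `Σ - (n - 2)π` of a configuration with `n` vertices on its boundary, `Σ` the sum
of its valence angles there. -/
def imbalance (C : Finset ι) : ℝ :=
  (∑ᶠ x ∈ T.boundaryVertices C, T.configurationAngle C x) -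
    ((T.boundaryVertices C).ncard - 2 : ℝ) * π

/-- Only finitely many tiles meet at a point, so that `valence` is a true count. -/
theorem finite_tiles_at (x : X) : {i | x ∈ T.tile i}.Finite := T.locallyFinite.point_finite x

/-- A configuration has finitely many boundary vertices, so that `imbalance` uses a true finite sum
and a true count. -/
theorem boundaryVertices_finite (C : Finset ι) : (T.boundaryVertices C).Finite := by
  have hsub : T.boundaryVertices C ⊆ ⋃ i ∈ C, T.tileVertices i := by
    rintro x ⟨hxV, hxF⟩
    have h2 : x ∈ ⋃ i ∈ C, closure (T.tile i) := by
      rw [← C.closure_biUnion]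
      exact hxF.1
    simp only [Set.mem_iUnion] at h2 ⊢
    obtain ⟨i, hi, hx⟩ := h2
    refine ⟨i, hi, hxV, hx, fun h => hxF.2 ?_⟩
    exact interior_mono (Set.subset_biUnion_of_mem (u := fun i => T.tile i) hi) h
  exact (C.finite_toSet.biUnion fun i _ => T.finite_vertex i).subset hsub

end Tessellation

end

/-! The identity is a linear combination of two counts. Let a configuration have `V` vertices, `E`
edges and `F` tiles, with `n` vertices on its boundary. An edge is a component of a tile boundary
minus the vertices. Away from vertices at most two tiles meet, so each edge borders exactly two
tiles of the tessellation, and `2E = ∑ n_t + n` (`two_mul_ncard_edges`). Summed over the tiles, the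
valence angles give the angle of the configuration at each boundary vertex and `2π` at each of the
`V - n` interior vertices. Together with Euler's formula `E + 1 = V + F` this gives `K = ∑ K_t`. For
the estimate, `K - 2π` is the sum of `angle - π` over the boundary vertices, of which there is at
least one, and each angle lies strictly between `0` and `2π`.

Euler's formula (`ncard_edges_add_one`) is a rank count for integer cochains `ℤ^V → ℤ^E → ℤ^F`. The
first map `δ` is the coboundary. The second map `ω` takes edge winding numbers `c` to the winding
numbers around the tile boundaries of a function on the skeleton that winds `c e` times along `e`.
The kernel of `δ` consists of the constants, because the skeleton is connected. The kernel of `ω` is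
the image of `δ`: logarithms on the tile boundaries extend over the tiles, their exponentials glue
to a nonvanishing function on the disk, and such a function has a logarithm. The rank of `ω` is `F`,
because in a disk coordinate `ψ` the function `ψ - ψ c`, with `c` inside one tile, winds around that
tile only.

The topology of the plane enters only through continuous logarithms. An odd function on the circle
has none; this yields invariance of domain, which identifies interiors and frontiers of disks in the
surface with the open disk and the circle. -/

section
open Set Metric Topology

/-! ### Continuous logarithms of nonvanishing complex functions. -/

section Logarithm

/-- `f` has a continuous logarithm on `S`. -/
def HasLogOn {X : Type*} [TopologicalSpace X] (f : X → ℂ) (S : Set X) : Prop :=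
  ∃ g : X → ℂ, ContinuousOn g S ∧ ∀ x ∈ S, Complex.exp (g x) = f x

namespace HasLogOn

variable {X Y : Type*} [TopologicalSpace X] [TopologicalSpace Y] {f f' : X → ℂ} {S S' : Set X}

theorem congr (h : HasLogOn f S) (hf : EqOn f' f S) : HasLogOn f' S := by
  obtain ⟨g, hg, he⟩ := h
  exact ⟨g, hg, fun x hx => by rw [he x hx, hf hx]⟩

theorem mono (h : HasLogOn f S) (hS : S' ⊆ S) : HasLogOn f S' := by
  obtain ⟨g, hg, he⟩ := h
  exact ⟨g, hg.mono hS, fun x hx => he x (hS hx)⟩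

theorem mul (h : HasLogOn f S) (h' : HasLogOn f' S) : HasLogOn (fun x => f x * f' x) S := by
  obtain ⟨g, hg, he⟩ := h
  obtain ⟨g', hg', he'⟩ := h'
  exact ⟨fun x => g x + g' x, hg.add hg', fun x hx => by
    rw [Complex.exp_add, he x hx, he' x hx]⟩

theorem div (h : HasLogOn f S) (h' : HasLogOn f' S) : HasLogOn (fun x => f x / f' x) S := by
  obtain ⟨g, hg, he⟩ := h
  obtain ⟨g', hg', he'⟩ := h'
  exact ⟨fun x => g x - g' x, hg.sub hg', fun x hx => by
    rw [Complex.exp_sub, he x hx, he' x hx]⟩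

theorem comp {T : Set Y} {q : Y → X} (h : HasLogOn f S) (hq : ContinuousOn q T)
    (hm : MapsTo q T S) : HasLogOn (fun y => f (q y)) T := by
  obtain ⟨g, hg, he⟩ := h
  exact ⟨fun y => g (q y), hg.comp hq hm, fun y hy => he _ (hm hy)⟩

theorem of_slitPlane (hf : ContinuousOn f S) (h : ∀ x ∈ S, f x ∈ Complex.slitPlane) :
    HasLogOn f S :=
  ⟨fun x => Complex.log (f x), hf.clog h, fun x hx =>
    Complex.exp_log (Complex.slitPlane_ne_zero (h x hx))⟩

/-- Having a logarithm is invariant under homotopies through nonvanishing functions. -/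
theorem homotopy {H : ℝ → X → ℂ}
    (hH : ContinuousOn (fun p : ℝ × X => H p.1 p.2) (Icc (0 : ℝ) 1 ×ˢ S))
    (h0 : ∀ t ∈ Icc (0 : ℝ) 1, ∀ x ∈ S, H t x ≠ 0) (h : HasLogOn (H 0) S) :
    HasLogOn (H 1) S := by
  classical
  obtain ⟨g, hg, he⟩ := h
  -- The homotopy is lifted through the covering `exp : ℂ → ℂ \ {0}`, starting from the given
  -- logarithm at time `0`.
  let K : C(unitInterval × S, {z : ℂ // z ≠ 0}) :=
    ⟨fun p => ⟨H p.1 p.2, h0 _ p.1.2 _ p.2.2⟩, by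
      refine Continuous.subtype_mk ?_ _
      exact hH.comp_continuous (f := fun p : unitInterval × S => ((p.1 : ℝ), (p.2 : X)))
        (by fun_prop) fun p => ⟨p.1.2, p.2.2⟩⟩
  let G : C(S, ℂ) := ⟨fun x => g x, hg.domRestrict⟩
  have hK : ∀ a, K (0, a) = (⟨_, (G a).exp_ne_zero⟩ : {z : ℂ // z ≠ 0}) := fun a =>
    Subtype.ext (he a a.2).symm
  let L := Complex.isCoveringMap_exp.liftHomotopy K G hK
  have hL : ∀ p, Complex.exp (L p) = H p.1 p.2 := fun p =>
    congrArg Subtype.val (congrFun (Complex.isCoveringMap_exp.liftHomotopy_lifts K G hK) p)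
  refine ⟨fun x => if hx : x ∈ S then L (1, ⟨x, hx⟩) else 0, ?_, fun x hx => ?_⟩
  · rw [continuousOn_iff_continuous_domRestrict]
    have : S.domRestrict (fun x => if hx : x ∈ S then L (1, ⟨x, hx⟩) else 0)
        = fun x : S => L (1, x) := by
      ext x; simp
    rw [this]
    fun_prop
  · simpa [hx] using hL (1, ⟨x, hx⟩)

/-- The homotopy `f (t • x)` joins the constant `f 0`, which has a logarithm, to `f`. -/
theorem of_starConvex {E : Type*} [NormedAddCommGroup E] [NormedSpace ℝ E] {f : E → ℂ} {S : Set E}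
    (hS : StarConvex ℝ 0 S) (hne : (0 : E) ∈ S) (hf : ContinuousOn f S) (h0 : ∀ x ∈ S, f x ≠ 0) :
    HasLogOn f S := by
  have hm : ∀ t ∈ Icc (0 : ℝ) 1, ∀ x ∈ S, t • x ∈ S := fun t ht x hx => by
    simpa using hS hx (sub_nonneg.2 ht.2) ht.1 (by ring)
  have := homotopy (H := fun t x => f (t • x)) (S := S) ?_ (fun t ht x hx => h0 _ (hm t ht x hx)) ?_
  · exact this.congr fun x _ => by simp
  · exact hf.comp (f := fun p : ℝ × E => p.1 • p.2) (by fun_prop)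
      fun p hp => hm _ hp.1 _ hp.2
  · refine ⟨fun _ => Complex.log (f 0), continuousOn_const, fun x _ => ?_⟩
    simp [Complex.exp_log (h0 0 hne)]

theorem closedBall {f : ℂ → ℂ} (hf : ContinuousOn f (closedBall 0 1))
    (h0 : ∀ x ∈ Metric.closedBall (0 : ℂ) 1, f x ≠ 0) : HasLogOn f (Metric.closedBall 0 1) :=
  of_starConvex ((convex_closedBall (0 : ℂ) 1).starConvex (by simp)) (by simp) hf h0

theorem Icc {f : ℝ → ℂ} (hf : ContinuousOn f (Icc 0 1)) (h0 : ∀ x ∈ Set.Icc (0 : ℝ) 1, f x ≠ 0) :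
    HasLogOn f (Set.Icc 0 1) :=
  of_starConvex ((convex_Icc (0 : ℝ) 1).starConvex (by simp)) (by simp) hf h0

end HasLogOn

/-- The difference of two logarithms of the same function on a connected set is constant. -/
theorem exp_eq_exp_preconnected {X : Type*} [TopologicalSpace X] {S : Set X} (hS : IsPreconnected S)
    {g g' : X → ℂ} (hg : ContinuousOn g S) (hg' : ContinuousOn g' S)
    (h : ∀ x ∈ S, Complex.exp (g x) = Complex.exp (g' x)) :
    ∃ n : ℤ, ∀ x ∈ S, g x = g' x + n * (2 * π * Complex.I) := by
  rcases S.eq_empty_or_nonempty with rfl | ⟨x₀, hx₀⟩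
  · exact ⟨0, by simp⟩
  choose! n hn using fun x hx => Complex.exp_eq_exp_iff_exists_int.1 (h x hx)
  have hpi : (2 * π * Complex.I) ≠ 0 := Complex.two_pi_I_ne_zero
  have hc : ContinuousOn n S := by
    have h1 : ContinuousOn (fun x => ((n x : ℤ) : ℂ)) S := by
      refine ((hg.sub hg').div_const (2 * π * Complex.I)).congr fun x hx => ?_
      simp only [Pi.sub_apply, hn x hx]
      field_simp
      ring
    exact (Complex.isClosedEmbedding_intCast.isEmbedding.continuousOn_iff).2 h1
  refine ⟨n x₀, fun x hx => ?_⟩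
  rw [hn x hx, hS.constant hc hx hx₀]

theorem isPreconnected_sphere_complex : IsPreconnected (sphere (0 : ℂ) 1) :=
  isPreconnected_sphere (by rw [Complex.rank_real_complex]; norm_num) 0 1

/-- An odd function on the unit circle has no logarithm. -/
theorem not_hasLogOn_odd {f : ℂ → ℂ} (hf : ∀ w ∈ sphere (0 : ℂ) 1, f (-w) = -f w) :
    ¬ HasLogOn f (sphere (0 : ℂ) 1) := by
  rintro ⟨g, hg, he⟩
  have hneg : ∀ w ∈ sphere (0 : ℂ) 1, -w ∈ sphere (0 : ℂ) 1 := fun w hw => by simpa using hw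
  -- By oddness `g (-w) = g w + πi + 2πin` with one integer `n` for the whole circle. Adding the
  -- cases `w = 1` and `w = -1` gives `(2n + 1) * 2πi = 0`.
  obtain ⟨n, hn⟩ := exp_eq_exp_preconnected isPreconnected_sphere_complex
    (g := fun w => g (-w)) (g' := fun w => g w + π * Complex.I)
    (hg.comp continuous_neg.continuousOn hneg) (hg.add continuousOn_const) fun w hw => by
      rw [Complex.exp_add, Complex.exp_pi_mul_I, he _ hw, he _ (hneg w hw), hf w hw]; ring
  have h1 : (1 : ℂ) ∈ sphere (0 : ℂ) 1 := by simp
  have e1 := hn 1 h1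
  have e2 := hn (-1) (hneg 1 h1)
  simp only [neg_neg] at e2
  rw [e1] at e2
  have e3 : ((2 * n + 1 : ℤ) : ℂ) * (2 * π * Complex.I) = 0 := by
    push_cast
    linear_combination -e2
  rcases mul_eq_zero.1 e3 with h | h
  · have : (2 * n + 1 : ℤ) = 0 := by exact_mod_cast h
    omega
  · exact Complex.two_pi_I_ne_zero h

end Logarithm

/-! ### Invariance of domain in the plane. -/

section InvarianceOfDomain

theorem sub_mem_slitPlane {a b : ℂ} (hb : b ≠ 0) (h : ‖a‖ < ‖b‖) :
    (b - a) / b ∈ Complex.slitPlane := by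
  left
  have h1 : (b - a) / b = 1 - a / b := by field_simp
  have h2 : (a / b).re < 1 := (Complex.re_le_norm _).trans_lt (by
    rw [norm_div]; exact (div_lt_one (norm_pos_iff.2 hb)).2 h)
  rw [h1, Complex.sub_re, Complex.one_re]
  linarith

/-- If a value `p` close to `f 0` were omitted, `f - p` would have a logarithm on the disk. On the
circle `f - p` is a small perturbation of `f - f 0`, which would then have a logarithm as well;
injectivity allows a deformation of `f - f 0` into an odd function, which has none. -/
theorem image_closedBall_mem_nhds_aux {f : ℂ → ℂ} (hf : ContinuousOn f (closedBall 0 1))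
    (hi : InjOn f (closedBall 0 1)) : f '' closedBall 0 1 ∈ 𝓝 (f 0) := by
  have hsub : sphere (0 : ℂ) 1 ⊆ closedBall 0 1 := sphere_subset_closedBall
  have h0m : (0 : ℂ) ∈ closedBall (0 : ℂ) 1 := by simp
  have hfs : ContinuousOn f (sphere 0 1) := hf.mono hsub
  have hns : ∀ w ∈ sphere (0 : ℂ) 1, f w - f 0 ≠ 0 := fun w hw h => by
    have := hi (hsub hw) h0m (sub_eq_zero.1 h)
    subst this
    simp at hw
  obtain ⟨w₀, hw₀, hmin⟩ := (isCompact_sphere (0 : ℂ) 1).exists_isMinOn ⟨1, by simp⟩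
    ((hfs.sub (continuousOn_const (c := f 0))).norm)
  have hδ : 0 < ‖f w₀ - f 0‖ := norm_pos_iff.2 (hns w₀ hw₀)
  refine Filter.mem_of_superset (ball_mem_nhds _ hδ) (fun p hp => ?_)
  by_contra hpn
  have hlog : HasLogOn (fun w => f w - p) (closedBall 0 1) :=
    HasLogOn.closedBall (hf.sub continuousOn_const) fun w hw h =>
      hpn ⟨w, hw, sub_eq_zero.1 h⟩
  have hlog2 : HasLogOn (fun w => ((f w - f 0) - (p - f 0)) / (f w - f 0)) (sphere 0 1) := by
    refine HasLogOn.of_slitPlane ?_ fun w hw => sub_mem_slitPlane (hns w hw) ?_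
    · exact ((hfs.sub continuousOn_const).sub continuousOn_const).div
        (hfs.sub continuousOn_const) hns
    · rw [mem_ball, dist_eq_norm] at hp
      exact hp.trans_le (hmin hw)
  have hlog3 : HasLogOn (fun w => f w - f 0) (sphere 0 1) := by
    refine ((hlog.mono hsub).div hlog2).congr fun w hw => ?_
    have h1 := hns w hw
    have h2 : f w - p ≠ 0 := fun h => hpn ⟨w, hsub hw, sub_eq_zero.1 h⟩
    have h3 : (f w - f 0) - (p - f 0) = f w - p := by ring
    simp only [h3]
    field_simp
  have hmem : ∀ t ∈ Icc (0 : ℝ) 1, ∀ w ∈ sphere (0 : ℂ) 1,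
      ((1 + t : ℝ)⁻¹ : ℂ) * w ∈ closedBall (0 : ℂ) 1 ∧
      -((t * (1 + t)⁻¹ : ℝ) : ℂ) * w ∈ closedBall (0 : ℂ) 1 := by
    intro t ht w hw
    have hw' : ‖w‖ = 1 := by simpa using hw
    have h1 : 0 < 1 + t := by linarith [ht.1]
    constructor
    · rw [mem_closedBall_zero_iff, norm_mul, hw', ← Complex.ofReal_inv, Complex.norm_real, mul_one,
        norm_of_nonneg (by positivity)]
      exact inv_le_one_of_one_le₀ (by linarith [ht.1])
    · rw [mem_closedBall_zero_iff, norm_mul, hw', norm_neg, Complex.norm_real, mul_one,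
        norm_of_nonneg (mul_nonneg ht.1 (by positivity)), ← div_eq_mul_inv, div_le_one h1]
      linarith
  -- The two arguments `w / (1 + t)` and `-t w / (1 + t)` stay in the disk and never coincide, so
  -- the difference never vanishes. It runs from `f w - f 0` to the odd function `f (w / 2) - f (-w
  -- / 2)`.
  have hlog4 := HasLogOn.homotopy (S := sphere (0 : ℂ) 1)
    (H := fun t w => f (((1 + t : ℝ)⁻¹ : ℂ) * w) - f (-((t * (1 + t)⁻¹ : ℝ) : ℂ) * w)) ?_ ?_ ?_
  · refine not_hasLogOn_odd (fun w hw => ?_) hlog4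
    norm_num
  · have hc : ContinuousOn (fun p : ℝ × ℂ => ((1 + p.1 : ℝ)⁻¹ : ℝ)) (Icc (0 : ℝ) 1 ×ˢ sphere 0 1) :=
      ContinuousOn.inv₀ (by fun_prop) fun p hp => by have := hp.1.1; positivity
    refine ContinuousOn.sub (hf.comp ?_ fun p hp => (hmem _ hp.1 _ hp.2).1)
      (hf.comp ?_ fun p hp => (hmem _ hp.1 _ hp.2).2)
    · exact ((Complex.continuous_ofReal.comp_continuousOn hc).mul continuousOn_snd).congr
        fun p _ => by simp
    · exact ((Complex.continuous_ofReal.comp_continuousOn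
        (continuousOn_fst.mul hc)).neg.mul continuousOn_snd).congr fun p _ => by simp
  · intro t ht w hw h
    have h1 := hi (hmem t ht w hw).1 (hmem t ht w hw).2 (sub_eq_zero.1 h)
    have hw0 : w ≠ 0 := by rintro rfl; simp at hw
    have h2 := mul_right_cancel₀ hw0 h1
    rw [← Complex.ofReal_inv, ← Complex.ofReal_neg, Complex.ofReal_inj] at h2
    have h3 : 0 < (1 + t)⁻¹ := by have := ht.1; positivity
    nlinarith [mul_nonneg ht.1 h3.le]
  · refine hlog3.congr fun w _ => by simp

theorem image_closedBall_mem_nhds {f : ℂ → ℂ} {c : ℂ} {r : ℝ} (hr : 0 < r)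
    (hf : ContinuousOn f (closedBall c r)) (hi : InjOn f (closedBall c r)) :
    f '' closedBall c r ∈ 𝓝 (f c) := by
  have hm : MapsTo (fun w : ℂ => c + r * w) (closedBall 0 1) (closedBall c r) := fun w hw => by
    rw [mem_closedBall_zero_iff] at hw
    rw [mem_closedBall, dist_eq_norm, add_sub_cancel_left, norm_mul, Complex.norm_real,
      norm_of_nonneg hr.le]
    nlinarith
  have h := image_closedBall_mem_nhds_aux (f := fun w => f (c + r * w))
    (hf.comp (by fun_prop) hm) (hi.comp (fun a _ b _ hab => by
      have : (r : ℂ) ≠ 0 := by exact_mod_cast hr.ne'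
      simpa [this] using hab) hm)
  simp only [mul_zero, add_zero] at h
  refine Filter.mem_of_superset h ?_
  rintro _ ⟨w, hw, rfl⟩
  exact ⟨_, hm hw, rfl⟩

/-- **Invariance of domain** in the plane. -/
theorem isOpen_image_of_injOn_complex {U : Set ℂ} (hU : IsOpen U) {f : ℂ → ℂ}
    (hf : ContinuousOn f U) (hi : InjOn f U) : IsOpen (f '' U) := by
  rw [isOpen_iff_mem_nhds]
  rintro _ ⟨c, hc, rfl⟩
  obtain ⟨r, hr, hs⟩ := nhds_basis_closedBall.mem_iff.1 (hU.mem_nhds hc)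
  exact Filter.mem_of_superset (image_closedBall_mem_nhds hr (hf.mono hs) (hi.mono hs))
    (image_mono hs)

end InvarianceOfDomain

/-! ### Extending and gluing continuous functions. -/

section Gluing

variable {X : Type*} [TopologicalSpace X]

/-- Tietze extension inside a compact subset of a Hausdorff space. -/
theorem IsCompact.exists_extension [T2Space X] {K A : Set X} (hK : IsCompact K) (hA : IsClosed A)
    (hAK : A ⊆ K) {g : X → ℂ} (hg : ContinuousOn g A) :
    ∃ g' : X → ℂ, ContinuousOn g' K ∧ EqOn g' g A := by
  classical
  have : CompactSpace K := isCompact_iff_compactSpace.1 hK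
  let e : A → K := inclusion hAK
  have he : IsClosedEmbedding e :=
    .of_continuous_injective_isClosedMap (continuous_inclusion hAK) (inclusion_injective hAK)
      fun s hs => by
        have : CompactSpace A := isCompact_iff_compactSpace.1 (hK.of_isClosed_subset hA hAK)
        exact (hs.isCompact.image (continuous_inclusion hAK)).isClosed
  obtain ⟨G, hG⟩ := ContinuousMap.exists_extension' he (⟨fun x => g x, hg.domRestrict⟩ : C(A, ℂ))
  refine ⟨fun x => if hx : x ∈ K then G ⟨x, hx⟩ else 0, ?_, fun x hx => ?_⟩
  · rw [continuousOn_iff_continuous_domRestrict]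
    have : K.domRestrict (fun x => if hx : x ∈ K then G ⟨x, hx⟩ else 0) = G := by
      ext x; simp
    rw [this]
    fun_prop
  · have := congrFun hG ⟨x, hx⟩
    simp only [hAK hx, dif_pos]
    exact this

/-- Gluing of functions on the members of a finite family of closed sets. -/
theorem exists_glue {Y ι : Type*} [TopologicalSpace Y] [Nonempty Y] {C : Set ι} (hC : C.Finite)
    {t : ι → Set X} (ht : ∀ i ∈ C, IsClosed (t i)) (h : ι → X → Y)
    (hc : ∀ i ∈ C, ContinuousOn (h i) (t i))
    (hag : ∀ i ∈ C, ∀ j ∈ C, ∀ x ∈ t i, x ∈ t j → h i x = h j x) :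
    ∃ F : X → Y, ContinuousOn F (⋃ i ∈ C, t i) ∧ ∀ i ∈ C, EqOn F (h i) (t i) := by
  classical
  have : Nonempty ι ∨ IsEmpty ι := (isEmpty_or_nonempty ι).symm
  rcases this with hι | hι
  swap
  · exact ⟨fun _ => Classical.arbitrary Y, by simp, fun i => isEmptyElim i⟩
  let F : X → Y := fun x => h (Classical.epsilon fun i => i ∈ C ∧ x ∈ t i) x
  have hF : ∀ i ∈ C, EqOn F (h i) (t i) := fun i hi x hx => by
    have := Classical.epsilon_spec (p := fun i => i ∈ C ∧ x ∈ t i) ⟨i, hi, hx⟩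
    exact hag _ this.1 _ hi _ this.2 hx
  refine ⟨F, ?_, hF⟩
  have : Finite C := hC
  rw [biUnion_eq_iUnion]
  exact (locallyFinite_of_finite _).continuousOn_iUnion (fun i => ht i i.2)
    fun i => (hc i i.2).congr (hF i i.2)

/-- A continuous map from a compact set to a Hausdorff space is closed, hence a quotient map onto
its image. This lets functions of a parameter descend to loops and edges. -/
theorem IsCompact.continuousOn_image {Y Z : Type*} [TopologicalSpace Y] [TopologicalSpace Z]
    [T2Space Y] {K : Set X} (hK : IsCompact K) {p : X → Y} (hp : ContinuousOn p K) {F : Y → Z}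
    (hF : ContinuousOn (fun x => F (p x)) K) : ContinuousOn F (p '' K) := by
  rw [continuousOn_iff_isClosed]
  intro c hc
  obtain ⟨u, hu, he⟩ := continuousOn_iff_isClosed.1 hF c hc
  have h1 : IsCompact (u ∩ K) := hK.inter_left hu
  refine ⟨p '' (u ∩ K), (h1.image_of_continuousOn (hp.mono inter_subset_right)).isClosed, ?_⟩
  ext y
  constructor
  · rintro ⟨hy, x, hx, rfl⟩
    have : x ∈ (fun x => F (p x)) ⁻¹' c ∩ K := ⟨hy, hx⟩
    rw [he] at this
    exact ⟨⟨x, this, rfl⟩, x, hx, rfl⟩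
  · rintro ⟨⟨x, hx, rfl⟩, h2⟩
    rw [← he] at hx
    exact ⟨hx.1, h2⟩

end Gluing

/-! ### Closed disks in a surface: interior, frontier and boundary loop. -/

section Surface

variable {X : Type*} [TopologicalSpace X]

/-- Mutually inverse parametrisations of a disk `s` by the closed unit disk. -/
structure IsDiskParam (f : ℂ → X) (g : X → ℂ) (s : Set X) : Prop where
  continuousOn : ContinuousOn f (closedBall 0 1)
  continuousOn_inv : ContinuousOn g s
  mapsTo : MapsTo f (closedBall 0 1) s
  mapsTo_inv : MapsTo g s (closedBall 0 1)
  left_inv : ∀ w ∈ closedBall (0 : ℂ) 1, g (f w) = w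
  right_inv : ∀ x ∈ s, f (g x) = x

theorem IsTopologicalDisk.exists_param {s : Set X} (h : IsTopologicalDisk s) :
    ∃ f g, IsDiskParam f g s := by
  classical
  obtain ⟨φ⟩ := h
  have h0 : (0 : ℂ) ∈ closedBall (0 : ℂ) 1 := by simp
  refine ⟨fun w => if hw : w ∈ closedBall (0 : ℂ) 1 then φ.symm ⟨w, hw⟩ else φ.symm ⟨0, h0⟩,
    fun x => if hx : x ∈ s then φ ⟨x, hx⟩ else 0, ⟨?_, ?_, ?_, ?_, ?_, ?_⟩⟩
  · rw [continuousOn_iff_continuous_domRestrict]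
    have : (closedBall (0 : ℂ) 1).domRestrict (fun w => if hw : w ∈ closedBall (0 : ℂ) 1 then
        (φ.symm ⟨w, hw⟩ : X) else φ.symm ⟨0, h0⟩) = fun w => (φ.symm w : X) := by
      ext w
      simp only [domRestrict_apply, Subtype.coe_prop, dif_pos, Subtype.coe_eta]
    rw [this]
    fun_prop
  · rw [continuousOn_iff_continuous_domRestrict]
    have : s.domRestrict (fun x => if hx : x ∈ s then (φ ⟨x, hx⟩ : ℂ) else 0)
        = fun x => (φ x : ℂ) := by
      ext x
      simp only [domRestrict_apply, Subtype.coe_prop, dif_pos, Subtype.coe_eta]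
    rw [this]
    fun_prop
  · intro w hw
    simp only [hw, dif_pos, Subtype.coe_prop]
  · intro x hx
    simp only [hx, dif_pos, Subtype.coe_prop]
  · intro w hw
    simp only [hw, dif_pos, Subtype.coe_prop, Subtype.coe_eta, Homeomorph.apply_symm_apply]
  · intro x hx
    simp only [hx, dif_pos, Subtype.coe_prop, Subtype.coe_eta, Homeomorph.symm_apply_apply]

/-- A loop running once around a simple closed curve `S`. -/
structure IsLoop (p : ℝ → X) (S : Set X) : Prop where
  continuousOn : ContinuousOn p (Icc 0 1)
  injOn : InjOn p (Ico 0 1)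
  zero_eq_one : p 0 = p 1
  image : p '' Icc 0 1 = S

namespace IsDiskParam

variable {f : ℂ → X} {g : X → ℂ} {s : Set X} (h : IsDiskParam f g s)
include h

theorem image_eq : f '' closedBall 0 1 = s :=
  Subset.antisymm h.mapsTo.image_subset fun x hx => ⟨g x, h.mapsTo_inv hx, h.right_inv x hx⟩

theorem injOn : InjOn f (closedBall 0 1) := fun a ha b hb hab => by
  rw [← h.left_inv a ha, ← h.left_inv b hb, hab]

theorem injOn_inv : InjOn g s := fun a ha b hb hab => by
  rw [← h.right_inv a ha, ← h.right_inv b hb, hab]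

theorem hasLogOn {u : X → ℂ} (hu : ContinuousOn u s) (h0 : ∀ x ∈ s, u x ≠ 0) : HasLogOn u s := by
  have := (HasLogOn.closedBall (hu.comp h.continuousOn h.mapsTo)
    fun w hw => h0 _ (h.mapsTo hw)).comp h.continuousOn_inv h.mapsTo_inv
  exact this.congr fun x hx => by simp [h.right_inv x hx]

end IsDiskParam

namespace IsTopologicalDisk

variable {s : Set X} (hs : IsTopologicalDisk s)
include hs

theorem isCompact : IsCompact s := by
  obtain ⟨f, g, h⟩ := hs.exists_param
  rw [← h.image_eq]
  exact (isCompact_closedBall 0 1).image_of_continuousOn h.continuousOn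

theorem isClosed [T2Space X] : IsClosed s := hs.isCompact.isClosed

theorem frontier_subset [T2Space X] : frontier s ⊆ s := hs.isClosed.frontier_subset

theorem isPreconnected : IsPreconnected s := by
  obtain ⟨f, g, h⟩ := hs.exists_param
  rw [← h.image_eq]
  exact (convex_closedBall (0 : ℂ) 1).isPreconnected.image _ h.continuousOn

theorem hasLogOn {u : X → ℂ} (hu : ContinuousOn u s) (h0 : ∀ x ∈ s, u x ≠ 0) : HasLogOn u s := by
  obtain ⟨f, g, h⟩ := hs.exists_param
  exact h.hasLogOn hu h0

end IsTopologicalDisk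

section Charted

variable [ChartedSpace (EuclideanSpace ℝ (Fin 2)) X]

theorem exists_complex_chart (x : X) : ∃ e : OpenPartialHomeomorph X ℂ, x ∈ e.source :=
  ⟨(chartAt (EuclideanSpace ℝ (Fin 2)) x).trans
    Complex.orthonormalBasisOneI.repr.symm.toHomeomorph.toOpenPartialHomeomorph,
    by simp⟩

/-- Invariance of domain for maps from the plane to a surface. -/
theorem isOpen_image_of_injOn_surface {U : Set ℂ} (hU : IsOpen U) {f : ℂ → X}
    (hf : ContinuousOn f U) (hi : InjOn f U) : IsOpen (f '' U) := by
  rw [isOpen_iff_mem_nhds]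
  rintro _ ⟨c, hc, rfl⟩
  obtain ⟨e, he⟩ := exists_complex_chart (f c)
  have hW : IsOpen (U ∩ f ⁻¹' e.source) := hf.isOpen_inter_preimage hU e.open_source
  have hm : MapsTo f (U ∩ f ⁻¹' e.source) e.source := fun w hw => hw.2
  have h1 : IsOpen ((e ∘ f) '' (U ∩ f ⁻¹' e.source)) :=
    isOpen_image_of_injOn_complex hW (e.continuousOn.comp (hf.mono inter_subset_left) hm)
      (e.injOn.comp (hi.mono inter_subset_left) hm)
  have h2 := e.isOpen_image_symm_of_subset_target h1 (by
    rintro _ ⟨w, hw, rfl⟩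
    exact e.map_source hw.2)
  refine Filter.mem_of_superset (h2.mem_nhds ⟨e (f c), ⟨c, ⟨hc, he⟩, rfl⟩, e.left_inv he⟩) ?_
  rintro _ ⟨_, ⟨w, hw, rfl⟩, rfl⟩
  exact ⟨w, hw.1, (e.left_inv hw.2).symm⟩

/-- Invariance of domain for maps from a surface to the plane. -/
theorem isOpen_image_of_injOn_to_complex {W : Set X} (hW : IsOpen W) {g : X → ℂ}
    (hg : ContinuousOn g W) (hi : InjOn g W) : IsOpen (g '' W) := by
  rw [isOpen_iff_mem_nhds]
  rintro _ ⟨x, hx, rfl⟩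
  obtain ⟨e, he⟩ := exists_complex_chart x
  have hU : IsOpen (e.target ∩ e.symm ⁻¹' W) := e.symm.continuousOn.isOpen_inter_preimage
    e.open_target hW
  have hm : MapsTo e.symm (e.target ∩ e.symm ⁻¹' W) W := fun w hw => hw.2
  have h1 : IsOpen ((g ∘ e.symm) '' (e.target ∩ e.symm ⁻¹' W)) :=
    isOpen_image_of_injOn_complex hU
      (hg.comp (e.symm.continuousOn.mono inter_subset_left) hm)
      (hi.comp (e.symm.injOn.mono inter_subset_left) hm)
  refine Filter.mem_of_superset (h1.mem_nhds
    ⟨e x, ⟨e.map_source he, by simpa [e.left_inv he] using hx⟩, by simp [e.left_inv he]⟩) ?_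
  rintro _ ⟨w, hw, rfl⟩
  exact ⟨_, hw.2, rfl⟩

namespace IsDiskParam

variable {f : ℂ → X} {g : X → ℂ} {s : Set X} (h : IsDiskParam f g s)
include h

/-- A disk is given only through its subspace topology, so its interior in the surface has to be
located by invariance of domain: in one direction for `g`, in the other for `f`. -/
theorem interior_eq : interior s = f '' ball 0 1 := by
  apply Subset.antisymm
  · intro x hx
    have h1 : IsOpen (g '' interior s) := isOpen_image_of_injOn_to_complex isOpen_interior
      (h.continuousOn_inv.mono interior_subset) (h.injOn_inv.mono interior_subset)
    have h2 : g '' interior s ⊆ interior (closedBall 0 1) := interior_maximal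
      ((image_mono interior_subset).trans h.mapsTo_inv.image_subset) h1
    rw [interior_closedBall _ one_ne_zero] at h2
    exact ⟨g x, h2 ⟨x, hx, rfl⟩, h.right_inv x (interior_subset hx)⟩
  · refine interior_maximal ?_ (isOpen_image_of_injOn_surface isOpen_ball
      (h.continuousOn.mono ball_subset_closedBall) (h.injOn.mono ball_subset_closedBall))
    exact (image_mono ball_subset_closedBall).trans h.mapsTo.image_subset

theorem norm_lt_one {x : X} (hx : x ∈ interior s) : ‖g x‖ < 1 := by
  rw [h.interior_eq] at hx
  obtain ⟨w, hw, rfl⟩ := hx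
  rw [h.left_inv w (ball_subset_closedBall hw)]
  simpa using hw

theorem frontier_eq [T2Space X] : frontier s = f '' sphere 0 1 := by
  have hc : IsClosed s := by
    rw [← h.image_eq]
    exact ((isCompact_closedBall 0 1).image_of_continuousOn h.continuousOn).isClosed
  rw [hc.frontier_eq, h.interior_eq, ← closedBall_sdiff_ball]
  nth_rw 1 [← h.image_eq]
  exact (h.injOn.image_sdiff_subset ball_subset_closedBall).symm

theorem norm_eq_one [T2Space X] {x : X} (hx : x ∈ frontier s) : ‖g x‖ = 1 := by
  rw [h.frontier_eq] at hx
  obtain ⟨w, hw, rfl⟩ := hx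
  rw [h.left_inv w (sphere_subset_closedBall hw)]
  simpa using hw

theorem exists_isLoop [T2Space X] {v : X} (hv : v ∈ frontier s) :
    ∃ p, IsLoop p (frontier s) ∧ p 0 = v := by
  have hv1 : ‖g v‖ = 1 := h.norm_eq_one hv
  have hv0 : g v ≠ 0 := fun h => by simp [h] at hv1
  have hvs : v ∈ s := by
    rw [h.frontier_eq] at hv
    rw [← h.image_eq]
    exact image_mono sphere_subset_closedBall hv
  -- The circle is traversed from `g v`, so that the loop is based at the prescribed point `v`.
  let c : ℝ → ℂ := fun t => g v * Complex.exp (2 * π * t * Complex.I)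
  have hcc : Continuous c := by fun_prop
  have hcs : ∀ t, c t ∈ sphere (0 : ℂ) 1 := fun t => by
    have : (2 * π * t * Complex.I : ℂ) = ((2 * π * t : ℝ) : ℂ) * Complex.I := by push_cast; ring
    simp [c, hv1, this, Complex.norm_exp_ofReal_mul_I, -Complex.ofReal_mul]
  have hcn : ∀ t (n : ℤ), c (t + n) = c t := fun t n => by
    have : (2 * π * (t + n : ℝ) * Complex.I : ℂ)
      = 2 * π * t * Complex.I + n * (2 * π * Complex.I) := by push_cast; ring
    simp only [c, this, Complex.exp_add, Complex.exp_int_mul_two_pi_mul_I, mul_one]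
  have hsurj : c '' Icc 0 1 = sphere 0 1 := by
    apply Subset.antisymm
    · rintro _ ⟨t, -, rfl⟩
      exact hcs t
    · intro w hw
      have hw1 : ‖w / g v‖ = 1 := by
        rw [norm_div, hv1]; simpa using hw
      set θ := (w / g v).arg with hθ
      have h1 : c (θ / (2 * π)) = w := by
        have h2 := Complex.norm_mul_exp_arg_mul_I (w / g v)
        have h3 : (2 * π * ((θ / (2 * π) : ℝ) : ℂ) * Complex.I) = θ * Complex.I := by
          push_cast
          have : (π : ℂ) ≠ 0 := by exact_mod_cast pi_ne_zero
          field_simp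
        rw [hw1, ← hθ] at h2
        simp only [c, h3]
        rw [← one_mul (Complex.exp _)]
        push_cast at h2
        rw [h2]
        field_simp
      refine ⟨Int.fract (θ / (2 * π)), ⟨Int.fract_nonneg _, (Int.fract_lt_one _).le⟩, ?_⟩
      rw [← h1, ← hcn _ ⌊θ / (2 * π)⌋, Int.fract_add_floor]
  refine ⟨fun t => f (c t), ⟨?_, ?_, ?_, ?_⟩, ?_⟩
  · exact h.continuousOn.comp hcc.continuousOn fun t _ => sphere_subset_closedBall (hcs t)
  · intro a ha b hb hab
    have h1 := h.injOn (sphere_subset_closedBall (hcs a)) (sphere_subset_closedBall (hcs b)) hab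
    have h2 := mul_left_cancel₀ hv0 h1
    obtain ⟨n, hn⟩ := Complex.exp_eq_exp_iff_exists_int.1 h2
    have h3 : (a : ℂ) = b + n := by
      have := Complex.two_pi_I_ne_zero
      apply mul_right_cancel₀ this
      linear_combination hn
    have h4 : a = b + n := by exact_mod_cast h3
    have h5 : ((n : ℤ) : ℝ) < 1 := by linarith [ha.2, hb.1]
    have h6 : (-1 : ℝ) < ((n : ℤ) : ℝ) := by linarith [ha.1, hb.2]
    have h7 : n < 1 := by exact_mod_cast h5
    have h8 : -1 < n := by exact_mod_cast h6
    have h9 : n = 0 := by omega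
    simpa [h9] using h4
  · have := hcn 0 1
    simp only [zero_add, Int.cast_one] at this
    simp only [this]
  · rw [h.frontier_eq, ← hsurj, image_image]
  · simp [c, h.right_inv v hvs]

end IsDiskParam

namespace IsTopologicalDisk

variable {s : Set X} (hs : IsTopologicalDisk s)
include hs

theorem subset_closure_interior : s ⊆ closure (interior s) := by
  obtain ⟨f, g, h⟩ := hs.exists_param
  rw [h.interior_eq, ← h.image_eq, ← closure_ball (0 : ℂ) one_ne_zero]
  exact ContinuousOn.image_closure (by rw [closure_ball _ one_ne_zero]; exact h.continuousOn)

theorem interior_nonempty : (interior s).Nonempty := by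
  obtain ⟨f, g, h⟩ := hs.exists_param
  rw [h.interior_eq]
  exact ⟨f 0, 0, by simp, rfl⟩

theorem frontier_nonempty [T2Space X] : (frontier s).Nonempty := by
  obtain ⟨f, g, h⟩ := hs.exists_param
  rw [h.frontier_eq]
  exact ⟨f 1, 1, by simp, rfl⟩

theorem isPreconnected_frontier [T2Space X] : IsPreconnected (frontier s) := by
  obtain ⟨f, g, h⟩ := hs.exists_param
  rw [h.frontier_eq]
  exact isPreconnected_sphere_complex.image _ (h.continuousOn.mono sphere_subset_closedBall)

theorem exists_isLoop [T2Space X] {v : X} (hv : v ∈ frontier s) :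
    ∃ p, IsLoop p (frontier s) ∧ p 0 = v := by
  obtain ⟨f, g, h⟩ := hs.exists_param
  exact h.exists_isLoop hv

end IsTopologicalDisk

end Charted

end Surface

/-! ### Cutting a simple closed curve into edges. -/

section Arcs

variable {X : Type*} [TopologicalSpace X]

/-- The edges into which the vertex set `V` divides `S`. -/
def edgesOf (V S : Set X) : Set (Set X) :=
  {e | ∃ x ∈ S \ V, e = connectedComponentIn (S \ V) x}

/-- A parametrisation of an edge with end points in the vertex set `V`. -/
structure IsEdgeParam (γ : ℝ → X) (e V : Set X) : Prop where
  continuousOn : ContinuousOn γ (Icc 0 1)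
  injOn : InjOn γ (Ioo 0 1)
  image : γ '' Ioo 0 1 = e
  zero_mem : γ 0 ∈ V
  one_mem : γ 1 ∈ V

theorem subset_of_mem_edgesOf {V S e : Set X} (he : e ∈ edgesOf V S) : e ⊆ S \ V := by
  obtain ⟨x, -, rfl⟩ := he
  exact connectedComponentIn_subset _ _

theorem eq_of_mem_edgesOf {V S e : Set X} (he : e ∈ edgesOf V S) {x : X} (hx : x ∈ e) :
    e = connectedComponentIn (S \ V) x := by
  obtain ⟨y, hy, rfl⟩ := he
  exact connectedComponentIn_eq hx

theorem IsEdgeParam.image_Icc [T2Space X] {γ : ℝ → X} {e V : Set X} (h : IsEdgeParam γ e V) :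
    γ '' Icc 0 1 = closure e := by
  apply Subset.antisymm
  · rw [← h.image, ← closure_Ioo (zero_ne_one' ℝ)]
    exact ContinuousOn.image_closure (by rw [closure_Ioo zero_ne_one]; exact h.continuousOn)
  · refine closure_minimal ?_ (isCompact_Icc.image_of_continuousOn h.continuousOn).isClosed
    rw [← h.image]
    exact image_mono Ioo_subset_Icc_self

namespace IsLoop

variable {p : ℝ → X} {S V : Set X} (h : IsLoop p S)
include h

theorem image_Ico : p '' Ico 0 1 = S := by
  rw [← h.image]
  apply Subset.antisymm (image_mono Ico_subset_Icc_self)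
  rintro _ ⟨s, hs, rfl⟩
  rcases hs.2.lt_or_eq with h1 | rfl
  · exact ⟨s, ⟨hs.1, h1⟩, rfl⟩
  · exact ⟨0, by simp, h.zero_eq_one⟩

/-- The closed arc and the image of the remaining parameters are closed and cover the curve. They
meet only in vertices, so a connected set without vertices cannot meet both. -/
theorem connectedComponentIn_eq_arc [T2Space X] (h0 : p 0 ∈ V) {u u' y : ℝ} (hu : 0 ≤ u)
    (hu' : u' ≤ 1) (hy : y ∈ Ioo u u') (huV : p u ∈ V) (huV' : p u' ∈ V)
    (hno : ∀ s ∈ Ioo u u', p s ∉ V) :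
    connectedComponentIn (S \ V) (p y) = p '' Ioo u u' := by
  have hsub : Ioo u u' ⊆ Ico 0 1 := fun s hs => ⟨hu.trans hs.1.le, hs.2.trans_le hu'⟩
  have hsub' : Icc u u' ⊆ Icc 0 1 := Icc_subset_Icc hu hu'
  have hA : p '' Ioo u u' ⊆ S \ V := by
    rintro _ ⟨s, hs, rfl⟩
    exact ⟨h.image_Ico ▸ mem_image_of_mem p (hsub hs), hno s hs⟩
  apply Subset.antisymm
  · have hpre : IsPreconnected (connectedComponentIn (S \ V) (p y)) :=
      isPreconnected_connectedComponentIn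
    have hyK : p y ∈ connectedComponentIn (S \ V) (p y) :=
      mem_connectedComponentIn (hA ⟨y, hy, rfl⟩)
    have hKS := connectedComponentIn_subset (S \ V) (p y)
    intro z hz
    by_contra hzA
    have hT1 : IsClosed (p '' Icc u u') :=
      (isCompact_Icc.image_of_continuousOn (h.continuousOn.mono hsub')).isClosed
    have hT2 : IsClosed (p '' (Icc 0 1 \ Ioo u u')) :=
      ((isCompact_Icc.diff isOpen_Ioo).image_of_continuousOn
        (h.continuousOn.mono sdiff_subset)).isClosed
    have hcov : ∀ z ∈ connectedComponentIn (S \ V) (p y), z ∉ p '' Ioo u u' →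
        z ∈ p '' (Icc 0 1 \ Ioo u u') := by
      intro z hz hzA
      have := (hKS hz).1
      rw [← h.image] at this
      obtain ⟨s, hs, rfl⟩ := this
      exact ⟨s, ⟨hs, fun hs' => hzA ⟨s, hs', rfl⟩⟩, rfl⟩
    obtain ⟨z', hz', ⟨a, ha, haz⟩, b, hb, hbz⟩ := isPreconnected_closed_iff.1 hpre _ _ hT1 hT2
      (fun z hz => by
        by_cases hzA : z ∈ p '' Ioo u u'
        · exact Or.inl (image_mono Ioo_subset_Icc_self hzA)
        · exact Or.inr (hcov z hz hzA))
      ⟨p y, hyK, y, Ioo_subset_Icc_self hy, rfl⟩ ⟨z, hz, hcov z hz hzA⟩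
    have hz'V := (hKS hz').2
    have ha' : a ∈ Ioo u u' := by
      refine ⟨lt_of_le_of_ne ha.1 ?_, lt_of_le_of_ne ha.2 ?_⟩
      · rintro rfl
        exact hz'V (haz ▸ huV)
      · rintro rfl
        exact hz'V (haz ▸ huV')
    have hb' : b ∈ Ico (0 : ℝ) 1 := by
      refine ⟨hb.1.1, lt_of_le_of_ne hb.1.2 ?_⟩
      rintro rfl
      exact hz'V (hbz ▸ h.zero_eq_one ▸ h0)
    have hab := h.injOn (hsub ha') hb' (haz.trans hbz.symm)
    exact hb.2 (hab ▸ ha')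
  · exact (isPreconnected_Ioo.image _ (h.continuousOn.mono
      (hsub.trans Ico_subset_Icc_self))).subset_connectedComponentIn ⟨y, hy, rfl⟩ hA

/-- Finitely many points divide a simple closed curve into as many arcs. -/
theorem edgesOf_spec [T2Space X] (hV : (V ∩ S).Finite) (h0 : p 0 ∈ V) :
    (edgesOf V S).Finite ∧ (edgesOf V S).ncard = (V ∩ S).ncard ∧
      (∀ e ∈ edgesOf V S, ∃ γ, IsEdgeParam γ e V) ∧ ∀ x ∈ S, ∃ e ∈ edgesOf V S, x ∈ closure e := by
  classical
  let P : Set ℝ := {u | u ∈ Ico (0 : ℝ) 1 ∧ p u ∈ V}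
  have hPi : InjOn p P := h.injOn.mono fun u hu => hu.1
  have hPim : p '' P = V ∩ S := by
    rw [← h.image_Ico]
    ext x
    constructor
    · rintro ⟨u, hu, rfl⟩
      exact ⟨hu.2, u, hu.1, rfl⟩
    · rintro ⟨hx, u, hu, rfl⟩
      exact ⟨u, ⟨hu, hx⟩, rfl⟩
  have hPf : P.Finite := Finite.of_finite_image (hPim ▸ hV) hPi
  have h0P : (0 : ℝ) ∈ P := ⟨by simp, h0⟩
  -- Each vertex parameter has a successor, the last one having `1`, which represents the base point
  -- again. As the base point is a vertex, every edge starts at exactly one vertex parameter. With a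
  -- single vertex, the edge has both ends there.
  have hnext : ∀ u ∈ P, ∃ u', u < u' ∧ u' ≤ 1 ∧ (u' = 1 ∨ u' ∈ P) ∧ ∀ y ∈ P, u < y → u' ≤ y := by
    intro u hu
    obtain ⟨m, hm, hmin⟩ := Set.exists_min_image ({y ∈ insert 1 P | u < y}) id
      ((hPf.insert 1).subset (sep_subset _ _)) ⟨1, mem_insert _ _, hu.1.2⟩
    exact ⟨m, hm.2, hmin 1 ⟨mem_insert _ _, hu.1.2⟩, hm.1, fun y hy huy =>
      hmin y ⟨mem_insert_of_mem _ hy, huy⟩⟩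
  choose! nx hlt hle hor hmin using hnext
  have hnV : ∀ u ∈ P, p (nx u) ∈ V := fun u hu => by
    rcases hor u hu with h1 | h1
    · rw [h1, ← h.zero_eq_one]
      exact h0
    · exact h1.2
  have hno : ∀ u ∈ P, ∀ s ∈ Ioo u (nx u), p s ∉ V := fun u hu s hs hsV =>
    hs.2.not_ge (hmin u hu s ⟨⟨hu.1.1.trans hs.1.le, hs.2.trans_le (hle u hu)⟩, hsV⟩ hs.1)
  have hex : ∀ s ∈ Ico (0 : ℝ) 1, ∃ u ∈ P, u ≤ s ∧ s < nx u := by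
    intro s hs
    obtain ⟨m, hm, hmax⟩ := Set.exists_max_image {y ∈ P | y ≤ s} id
      (hPf.subset (sep_subset _ _)) ⟨0, h0P, hs.1⟩
    refine ⟨m, hm.1, hm.2, ?_⟩
    by_contra hcon
    push Not at hcon
    rcases hor m hm.1 with h1 | h1
    · linarith [hs.2]
    · exact absurd (hmax (nx m) ⟨h1, hcon⟩) (not_le.2 (hlt m hm.1))
  let A : ℝ → Set X := fun u => p '' Ioo u (nx u)
  have hcc : ∀ u ∈ P, ∀ y ∈ Ioo u (nx u), connectedComponentIn (S \ V) (p y) = A u :=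
    fun u hu y hy => h.connectedComponentIn_eq_arc h0 hu.1.1 (hle u hu) hy hu.2 (hnV u hu)
      (hno u hu)
  have hIco : ∀ u ∈ P, Ioo u (nx u) ⊆ Ico 0 1 := fun u hu s hs =>
    ⟨hu.1.1.trans hs.1.le, hs.2.trans_le (hle u hu)⟩
  have hedges : edgesOf V S = A '' P := by
    ext e
    constructor
    · rintro ⟨x, hx, rfl⟩
      have := hx.1
      rw [← h.image_Ico] at this
      obtain ⟨s, hs, rfl⟩ := this
      obtain ⟨u, hu, h1, h2⟩ := hex s hs
      refine ⟨u, hu, (hcc u hu s ⟨lt_of_le_of_ne h1 ?_, h2⟩).symm⟩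
      rintro rfl
      exact hx.2 hu.2
    · rintro ⟨u, hu, rfl⟩
      obtain ⟨y, hy⟩ := nonempty_Ioo.2 (hlt u hu)
      exact ⟨p y, ⟨h.image_Ico ▸ mem_image_of_mem p (hIco u hu hy), hno u hu y hy⟩,
        (hcc u hu y hy).symm⟩
  have hAinj : InjOn A P := by
    have key : ∀ u ∈ P, ∀ v ∈ P, u < v → A u ≠ A v := by
      intro u hu v hv huv hA
      obtain ⟨y, hy⟩ := nonempty_Ioo.2 (hlt v hv)
      have : p y ∈ A u := hA ▸ ⟨y, hy, rfl⟩
      obtain ⟨z, hz, hzy⟩ := this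
      have := h.injOn (hIco u hu hz) (hIco v hv hy) hzy
      subst this
      exact absurd (hmin u hu v hv huv) (not_le.2 (hy.1.trans hz.2))
    intro u hu v hv hA
    rcases lt_trichotomy u v with h1 | h1 | h1
    · exact absurd hA (key u hu v hv h1)
    · exact h1
    · exact absurd hA.symm (key v hv u hu h1)
  refine ⟨hedges ▸ hPf.image A, ?_, ?_, ?_⟩
  · rw [hedges, hAinj.ncard_image, ← hPim, hPi.ncard_image]
  · rw [hedges]
    rintro _ ⟨u, hu, rfl⟩
    have hd : 0 < nx u - u := sub_pos.2 (hlt u hu)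
    refine ⟨fun t => p (u + t * (nx u - u)), ⟨?_, ?_, ?_, ?_, ?_⟩⟩
    · refine h.continuousOn.comp (by fun_prop) fun t ht => ⟨?_, ?_⟩
      · have := hu.1.1
        have := mul_nonneg ht.1 hd.le
        linarith
      · nlinarith [hle u hu, ht.2]
    · intro a ha b hb hab
      have hm : ∀ t ∈ Ioo (0 : ℝ) 1, u + t * (nx u - u) ∈ Ioo u (nx u) := fun t ht =>
        ⟨by nlinarith [ht.1], by nlinarith [ht.2]⟩
      have := h.injOn (hIco u hu (hm a ha)) (hIco u hu (hm b hb)) hab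
      exact mul_right_cancel₀ hd.ne' (add_left_cancel this)
    · apply Subset.antisymm
      · rintro _ ⟨t, ht, rfl⟩
        exact ⟨_, ⟨by nlinarith [ht.1], by nlinarith [ht.2]⟩, rfl⟩
      · rintro _ ⟨s, hs, rfl⟩
        refine ⟨(s - u) / (nx u - u), ⟨div_pos (by linarith [hs.1]) hd, ?_⟩, ?_⟩
        · rw [div_lt_one hd]
          linarith [hs.2]
        · simp only
          rw [div_mul_cancel₀ _ hd.ne', add_sub_cancel]
    · simpa using hu.2
    · simpa using hnV u hu
  · intro x hx
    rw [← h.image_Ico] at hx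
    obtain ⟨s, hs, rfl⟩ := hx
    obtain ⟨u, hu, h1, h2⟩ := hex s hs
    refine ⟨A u, hedges ▸ mem_image_of_mem A hu, ?_⟩
    have hcl := closure_Ioo (hlt u hu).ne
    refine ContinuousOn.image_closure (s := Ioo u (nx u)) (f := p) ?_ ⟨s, ?_, rfl⟩
    · rw [hcl]
      exact h.continuousOn.mono (Icc_subset_Icc hu.1.1 (hle u hu))
    · rw [hcl]
      exact ⟨h1, h2.le⟩

end IsLoop

end Arcs

theorem IsPreconnected.subset_of_closed_cover {X : Type*} [TopologicalSpace X] {K A B : Set X}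
    (hK : IsPreconnected K) (hA : IsClosed A) (hB : IsClosed B) (hcov : K ⊆ A ∪ B)
    (hd : ∀ z ∈ K, z ∈ A → z ∉ B) {x : X} (hx : x ∈ K) (hxA : x ∈ A) : K ⊆ A := by
  intro z hz
  by_contra hzA
  obtain ⟨w, hw, h1, h2⟩ := isPreconnected_closed_iff.1 hK A B hA hB hcov ⟨x, hx, hxA⟩
    ⟨z, hz, (hcov hz).resolve_left hzA⟩
  exact hd w hw h1 h2

/-! ### Combinatorics of a tessellation: frontiers, edges and their count. -/

namespace Tessellation

variable {X : Type*} [TopologicalSpace X] {ι : Type*} (T : Tessellation X ι)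

theorem mem_region {C : Finset ι} {x : X} : x ∈ T.region C ↔ ∃ i ∈ C, x ∈ T.tile i := by
  simp [region]

theorem region_singleton (i : ι) : T.region {i} = T.tile i := by
  simp [region]

theorem exists_mem_tile (x : X) : ∃ i, x ∈ T.tile i := by
  have : x ∈ ⋃ i, T.tile i := T.covers ▸ mem_univ x
  simpa using this

theorem eq_or_eq_of_notMem_vertex {i j k : ι} (hij : i ≠ j) {x : X} (hi : x ∈ T.tile i)
    (hj : x ∈ T.tile j) (hk : x ∈ T.tile k) (hx : x ∉ T.vertex) : k = i ∨ k = j := by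
  by_contra h
  push Not at h
  exact hx (T.mem_vertex i j k hij h.1.symm h.2.symm x hi hj hk)

section T2

variable [T2Space X]

theorem isClosed_tile (i : ι) : IsClosed (T.tile i) := (T.isDisk i).isClosed

theorem isClosed_region (C : Finset ι) : IsClosed (T.region C) :=
  C.finite_toSet.isClosed_biUnion fun i _ => T.isClosed_tile i

theorem isClosed_iUnion_tile (s : Set ι) : IsClosed (⋃ i ∈ s, T.tile i) := by
  rw [biUnion_eq_iUnion]
  exact (T.locallyFinite.comp_injective Subtype.val_injective).isClosed_iUnion
    fun i => T.isClosed_tile i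

end T2

variable [ChartedSpace (EuclideanSpace ℝ (Fin 2)) X]

/-- A disk is the closure of its interior. A point of tile `j` interior to tile `i` would therefore
have interior points of `j` nearby that are interior to `i`. -/
theorem mem_frontier_tile {i j : ι} (hij : i ≠ j) {x : X} (hi : x ∈ T.tile i)
    (hj : x ∈ T.tile j) : x ∈ frontier (T.tile i) := by
  refine ⟨subset_closure hi, fun h => ?_⟩
  obtain ⟨y, hy⟩ := mem_closure_iff.1 ((T.isDisk j).subset_closure_interior hj) _
    isOpen_interior h
  exact (T.disjoint_interior hij).le_bot hy

variable [T2Space X]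

/-- Consequently the vertices of a tile are all the vertices that it contains, which is what
counting by incidence requires. -/
theorem mem_frontier_of_mem_vertex {i : ι} {x : X} (hx : x ∈ T.vertex) (hi : x ∈ T.tile i) :
    x ∈ frontier (T.tile i) := by
  obtain ⟨j, hj⟩ := mem_iUnion.1 (T.vertex_subset hx)
  by_cases hij : i = j
  · exact hij ▸ hj
  · exact T.mem_frontier_tile hij hi ((T.isDisk j).frontier_subset hj)

/-- By local finiteness the tiles outside `C` have a closed union, which contains the closure of the
complement of the region. Conversely, a tile outside `C` has interior points near each of its
points, and these lie in no tile of `C`. -/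
theorem mem_frontier_region {C : Finset ι} {x : X} :
    x ∈ frontier (T.region C) ↔ (∃ i ∈ C, x ∈ T.tile i) ∧ ∃ j ∉ C, x ∈ T.tile j := by
  constructor
  · intro hx
    refine ⟨T.mem_region.1 ((T.isClosed_region C).frontier_subset hx), ?_⟩
    have h1 : (T.region C)ᶜ ⊆ ⋃ j ∈ (C : Set ι)ᶜ, T.tile j := by
      intro y hy
      obtain ⟨j, hj⟩ := T.exists_mem_tile y
      simp only [mem_iUnion]
      exact ⟨j, fun hjC => hy (T.mem_region.2 ⟨j, hjC, hj⟩), hj⟩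
    have h2 := closure_minimal h1 (T.isClosed_iUnion_tile _)
    rw [← frontier_compl] at hx
    simpa using h2 hx.1
  · rintro ⟨⟨i, hi, hxi⟩, j, hj, hxj⟩
    refine ⟨subset_closure (T.mem_region.2 ⟨i, hi, hxi⟩), fun h => ?_⟩
    obtain ⟨y, hy, hyj⟩ := mem_closure_iff.1 ((T.isDisk j).subset_closure_interior hxj) _
      isOpen_interior h
    obtain ⟨k, hk, hyk⟩ := T.mem_region.1 (interior_subset hy)
    have hjk : j ≠ k := by
      rintro rfl
      exact hj hk
    exact (T.mem_frontier_tile hjk (interior_subset hyj) hyk).2 hyj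

/-- Off the vertices, a frontier point lies in exactly one tile of `C` and exactly one outside. A
connected piece of the frontier cannot change either of them, since the competing tiles form
disjoint closed parts of it. Thus the edge depends only on the pair `i`, `j` and not on `C`. -/
theorem connectedComponentIn_frontier_region {C : Finset ι} {i j : ι} (hi : i ∈ C) (hj : j ∉ C)
    {x : X} (hxi : x ∈ T.tile i) (hxj : x ∈ T.tile j) (hx : x ∉ T.vertex) :
    connectedComponentIn (frontier (T.region C) \ T.vertex) x =
      connectedComponentIn ((T.tile i ∩ T.tile j) \ T.vertex) x := by
  have hxF : x ∈ frontier (T.region C) \ T.vertex :=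
    ⟨T.mem_frontier_region.2 ⟨⟨i, hi, hxi⟩, j, hj, hxj⟩, hx⟩
  have hxK := mem_connectedComponentIn hxF
  have hKF := connectedComponentIn_subset (frontier (T.region C) \ T.vertex) x
  have hpre : IsPreconnected (connectedComponentIn (frontier (T.region C) \ T.vertex) x) :=
    isPreconnected_connectedComponentIn
  apply Subset.antisymm
  · refine hpre.subset_connectedComponentIn hxK fun z hz => ⟨⟨?_, ?_⟩, (hKF hz).2⟩
    · refine hpre.subset_of_closed_cover (T.isClosed_tile i)
        (T.isClosed_iUnion_tile {k | k ∈ C ∧ k ≠ i}) (fun z hz => ?_) (fun z hz hzi hzk => ?_)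
        hxK hxi hz
      · obtain ⟨k, hk, hzk⟩ := (T.mem_frontier_region.1 (hKF hz).1).1
        by_cases hki : k = i
        · exact Or.inl (hki ▸ hzk)
        · exact Or.inr (mem_biUnion (show k ∈ {k | k ∈ C ∧ k ≠ i} from ⟨hk, hki⟩) hzk)
      · obtain ⟨k, hk, hzk⟩ := mem_iUnion₂.1 hzk
        obtain ⟨l, hl, hzl⟩ := (T.mem_frontier_region.1 (hKF hz).1).2
        rcases T.eq_or_eq_of_notMem_vertex hk.2.symm hzi hzk hzl (hKF hz).2 with rfl | rfl
        · exact hl hi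
        · exact hl hk.1
    · refine hpre.subset_of_closed_cover (T.isClosed_tile j)
        (T.isClosed_iUnion_tile {k | k ∉ C ∧ k ≠ j}) (fun z hz => ?_) (fun z hz hzi hzk => ?_)
        hxK hxj hz
      · obtain ⟨k, hk, hzk⟩ := (T.mem_frontier_region.1 (hKF hz).1).2
        by_cases hki : k = j
        · exact Or.inl (hki ▸ hzk)
        · exact Or.inr (mem_biUnion (show k ∈ {k | k ∉ C ∧ k ≠ j} from ⟨hk, hki⟩) hzk)
      · obtain ⟨k, hk, hzk⟩ := mem_iUnion₂.1 hzk
        obtain ⟨l, hl, hzl⟩ := (T.mem_frontier_region.1 (hKF hz).1).1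
        rcases T.eq_or_eq_of_notMem_vertex hk.2.symm hzi hzk hzl (hKF hz).2 with rfl | rfl
        · exact hj hl
        · exact hk.1 hl
  · refine connectedComponentIn_mono x fun z hz => ⟨?_, hz.2⟩
    exact T.mem_frontier_region.2 ⟨⟨i, hi, hz.1.1⟩, j, hj, hz.1.2⟩

/-- An edge between the tiles `i` and `j` lies on the boundary of those collections of tiles
that contain exactly one of them. -/
theorem mem_edgesOf_frontier_region_iff {i j : ι} (hij : i ≠ j) {x : X} (hxi : x ∈ T.tile i)
    (hxj : x ∈ T.tile j) (hx : x ∉ T.vertex) (D : Finset ι) :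
    connectedComponentIn ((T.tile i ∩ T.tile j) \ T.vertex) x
        ∈ edgesOf T.vertex (frontier (T.region D)) ↔ (i ∈ D ∧ j ∉ D) ∨ (j ∈ D ∧ i ∉ D) := by
  constructor
  · intro he
    have hxe := subset_of_mem_edgesOf he
      (mem_connectedComponentIn ⟨⟨hxi, hxj⟩, hx⟩)
    obtain ⟨⟨k, hk, hxk⟩, l, hl, hxl⟩ := T.mem_frontier_region.1 hxe.1
    rcases T.eq_or_eq_of_notMem_vertex hij hxi hxj hxk hx with rfl | rfl <;>
    rcases T.eq_or_eq_of_notMem_vertex hij hxi hxj hxl hx with rfl | rfl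
    · exact absurd hk hl
    · exact Or.inl ⟨hk, hl⟩
    · exact Or.inr ⟨hk, hl⟩
    · exact absurd hk hl
  · rintro (⟨hi, hj⟩ | ⟨hj, hi⟩)
    · exact ⟨x, ⟨T.mem_frontier_region.2 ⟨⟨i, hi, hxi⟩, j, hj, hxj⟩, hx⟩,
        (T.connectedComponentIn_frontier_region hi hj hxi hxj hx).symm⟩
    · refine ⟨x, ⟨T.mem_frontier_region.2 ⟨⟨j, hj, hxj⟩, i, hi, hxi⟩, hx⟩, ?_⟩
      rw [T.connectedComponentIn_frontier_region hj hi hxj hxi hx, inter_comm]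

theorem exists_pair_of_mem_edgesOf {D : Finset ι} {e : Set X}
    (he : e ∈ edgesOf T.vertex (frontier (T.region D))) :
    ∃ i ∈ D, ∃ j ∉ D, ∀ D' : Finset ι, e ∈ edgesOf T.vertex (frontier (T.region D')) ↔
      (i ∈ D' ∧ j ∉ D') ∨ (j ∈ D' ∧ i ∉ D') := by
  obtain ⟨x, hx, rfl⟩ := he
  obtain ⟨⟨i, hi, hxi⟩, j, hj, hxj⟩ := T.mem_frontier_region.1 hx.1
  have hij : i ≠ j := by
    rintro rfl
    exact hj hi
  rw [T.connectedComponentIn_frontier_region hi hj hxi hxj hx.2]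
  exact ⟨i, hi, j, hj, T.mem_edgesOf_frontier_region_iff hij hxi hxj hx.2⟩

/-- The edges of the tiles of a collection. -/
def edges (C : Finset ι) : Set (Set X) := ⋃ i ∈ C, edgesOf T.vertex (frontier (T.tile i))

theorem edgesOf_tile_spec (i : ι) :
    (edgesOf T.vertex (frontier (T.tile i))).Finite ∧
      (edgesOf T.vertex (frontier (T.tile i))).ncard = (T.tileVertices i).ncard ∧
      (∀ e ∈ edgesOf T.vertex (frontier (T.tile i)), ∃ γ, IsEdgeParam γ e T.vertex) ∧
      ∀ x ∈ frontier (T.tile i), ∃ e ∈ edgesOf T.vertex (frontier (T.tile i)), x ∈ closure e := by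
  obtain ⟨v, hv, hvF⟩ := T.nonempty_vertex i
  obtain ⟨p, hp, rfl⟩ := (T.isDisk i).exists_isLoop hvF
  exact hp.edgesOf_spec (T.finite_vertex i) hv

theorem finite_edges (C : Finset ι) : (T.edges C).Finite :=
  C.finite_toSet.biUnion fun i _ => (T.edgesOf_tile_spec i).1

theorem edgesOf_frontier_region_subset (C : Finset ι) :
    edgesOf T.vertex (frontier (T.region C)) ⊆ T.edges C := by
  intro e he
  obtain ⟨i, hi, j, hj, h⟩ := T.exists_pair_of_mem_edgesOf he
  refine mem_biUnion (show i ∈ C from hi) ?_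
  rw [← T.region_singleton i, h]
  left
  simp only [Finset.mem_singleton, true_and]
  rintro rfl
  exact hj hi

/-- Without vertices the whole frontier would be a single edge, hence an edge of some tile. The
closure of such an edge contains a vertex, and the frontier is closed. -/
theorem boundaryVertices_nonempty {C : Finset ι} (hC : T.IsConfiguration C) :
    (T.boundaryVertices C).Nonempty := by
  by_contra hne
  rw [not_nonempty_iff_eq_empty] at hne
  have hd : frontier (T.region C) \ T.vertex = frontier (T.region C) := by
    rw [sdiff_eq_left, disjoint_comm, disjoint_iff_inter_eq_empty]
    exact hne
  obtain ⟨x, hx⟩ := hC.frontier_nonempty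
  have he : frontier (T.region C) ∈ edgesOf T.vertex (frontier (T.region C)) := by
    refine ⟨x, hd.symm ▸ hx, ?_⟩
    rw [hd]
    exact (hC.isPreconnected_frontier.connectedComponentIn hx).symm
  obtain ⟨i, -, hi⟩ := mem_iUnion₂.1 (T.edgesOf_frontier_region_subset C he)
  obtain ⟨γ, hγ⟩ := (T.edgesOf_tile_spec i).2.2.1 _ hi
  have h0 : γ 0 ∈ closure (frontier (T.region C)) :=
    hγ.image_Icc ▸ mem_image_of_mem γ (by simp)
  rw [isClosed_frontier.closure_eq] at h0
  exact (hne ▸ (⟨hγ.zero_mem, h0⟩ : γ 0 ∈ T.boundaryVertices C) : γ 0 ∈ (∅ : Set X))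

/-- Double counting: an edge with both its tiles in `C` is counted by two tiles and not by the
boundary; an edge with one tile in `C` is counted once by each. On each curve there are as many
edges as vertices. -/
theorem two_mul_ncard_edges {C : Finset ι} (hC : T.IsConfiguration C) :
    2 * (T.edges C).ncard = ∑ i ∈ C, (T.tileVertices i).ncard + (T.boundaryVertices C).ncard := by
  classical
  have hB : (edgesOf T.vertex (frontier (T.region C))).ncard = (T.boundaryVertices C).ncard := by
    obtain ⟨v, hv, hvF⟩ := T.boundaryVertices_nonempty hC
    obtain ⟨p, hp, rfl⟩ := hC.exists_isLoop hvF
    exact (hp.edgesOf_spec (T.boundaryVertices_finite C) hv).2.1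
  let E := (T.finite_edges C).toFinset
  have hcard : ∀ A : Set (Set X), A ⊆ T.edges C → A.ncard = ∑ e ∈ E, if e ∈ A then 1 else 0 := by
    intro A hA
    rw [Finset.sum_boole, Nat.cast_id, ← ncard_coe_finset]
    congr 1
    ext e
    simp only [Finset.coe_filter, mem_ofPred_eq, E, Finite.mem_toFinset]
    exact ⟨fun h => ⟨hA h, h⟩, fun h => h.2⟩
  have hsub : ∀ i ∈ C, edgesOf T.vertex (frontier (T.tile i)) ⊆ T.edges C := fun i hi e he =>
    mem_biUnion (show i ∈ C from hi) he
  rw [← hB, hcard _ (T.edgesOf_frontier_region_subset C),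
    Finset.sum_congr rfl fun i hi => by
      rw [← (T.edgesOf_tile_spec i).2.1, hcard _ (hsub i hi)],
    Finset.sum_comm, ← Finset.sum_add_distrib, ncard_eq_toFinset_card _ (T.finite_edges C),
    mul_comm, ← smul_eq_mul, ← Finset.sum_const]
  refine Finset.sum_congr rfl fun e he => ?_
  obtain ⟨i, hi, hei⟩ := mem_iUnion₂.1 ((T.finite_edges C).mem_toFinset.1 he)
  rw [← T.region_singleton i] at hei
  obtain ⟨i', hi', j, hj, h⟩ := T.exists_pair_of_mem_edgesOf hei
  rw [Finset.mem_singleton] at hi' hj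
  subst hi'
  have h1 : ∀ k, e ∈ edgesOf T.vertex (frontier (T.tile k)) ↔ k = i' ∨ k = j := by
    intro k
    rw [← T.region_singleton k, h]
    simp only [Finset.mem_singleton]
    grind
  have hiC : i' ∈ C := hi
  simp only [h1, h C, hiC, Finset.sum_boole]
  by_cases hjC : j ∈ C
  · have : {k ∈ C | k = i' ∨ k = j} = {i', j} := by
      ext k; simp only [Finset.mem_filter, Finset.mem_insert, Finset.mem_singleton]; grind
    rw [this, Finset.card_pair (Ne.symm hj)]
    simp [hjC]
  · have : {k ∈ C | k = i' ∨ k = j} = {i'} := by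
      ext k; simp only [Finset.mem_filter, Finset.mem_singleton]; grind
    rw [this]
    simp [hjC]

end Tessellation

/-! ### Winding numbers along loops, and functions on graphs. -/

section Winding

variable {X : Type*}

/-- The nonvanishing function `f` winds `n` times around `0` along the path `p`. -/
def HasWinding (p : ℝ → X) (f : X → ℂ) (n : ℤ) : Prop :=
  ∃ g : ℝ → ℂ, ContinuousOn g (Icc 0 1) ∧ (∀ t ∈ Icc (0 : ℝ) 1, Complex.exp (g t) = f (p t)) ∧
    g 1 = g 0 + n * (2 * π * Complex.I)

theorem HasWinding.unique {p : ℝ → X} {f : X → ℂ} {n m : ℤ} (h : HasWinding p f n)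
    (h' : HasWinding p f m) : n = m := by
  obtain ⟨g, hg, he, h1⟩ := h
  obtain ⟨g', hg', he', h1'⟩ := h'
  obtain ⟨k, hk⟩ := exp_eq_exp_preconnected isPreconnected_Icc hg hg'
    fun t ht => (he t ht).trans (he' t ht).symm
  have e0 := hk 0 (by simp)
  have e1 := hk 1 (by simp)
  have : (n : ℂ) = m := by
    apply mul_right_cancel₀ Complex.two_pi_I_ne_zero
    linear_combination e1 - e0 - h1 + h1'
  exact_mod_cast this

theorem HasWinding.mul {p : ℝ → X} {f f' : X → ℂ} {n m : ℤ} (h : HasWinding p f n)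
    (h' : HasWinding p f' m) : HasWinding p (fun x => f x * f' x) (n + m) := by
  obtain ⟨g, hg, he, h1⟩ := h
  obtain ⟨g', hg', he', h1'⟩ := h'
  refine ⟨fun t => g t + g' t, hg.add hg', fun t ht => ?_, ?_⟩
  · rw [Complex.exp_add, he t ht, he' t ht]
  · push_cast
    linear_combination h1 + h1'

theorem exists_int_of_exp_eq_exp {a b : ℂ} (h : Complex.exp a = Complex.exp b) :
    ∃ n : ℤ, a = b + n * (2 * π * Complex.I) := Complex.exp_eq_exp_iff_exists_int.1 h

namespace IsLoop

variable [TopologicalSpace X] {p : ℝ → X} {S : Set X} (h : IsLoop p S)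
include h

theorem mapsTo : MapsTo p (Icc 0 1) S := fun _ ht => h.image ▸ mem_image_of_mem p ht

theorem hasWinding_congr {f f' : X → ℂ} (hf : EqOn f f' S) {n : ℤ} (hw : HasWinding p f n) :
    HasWinding p f' n := by
  obtain ⟨g, hg, he, h1⟩ := hw
  exact ⟨g, hg, fun t ht => (he t ht).trans (hf (h.mapsTo ht)), h1⟩

theorem exists_hasWinding {f : X → ℂ} (hf : ContinuousOn f S) (h0 : ∀ x ∈ S, f x ≠ 0) :
    ∃ n, HasWinding p f n := by
  obtain ⟨g, hg, he⟩ := HasLogOn.Icc (hf.comp h.continuousOn h.mapsTo)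
    fun t ht => h0 _ (h.mapsTo ht)
  obtain ⟨n, hn⟩ := exists_int_of_exp_eq_exp (a := g 1) (b := g 0) (by
    rw [he 1 (by simp), he 0 (by simp), Function.comp, Function.comp, h.zero_eq_one])
  exact ⟨n, g, hg, he, hn⟩

theorem hasWinding_zero_of_hasLogOn {f : X → ℂ} (hf : HasLogOn f S) : HasWinding p f 0 := by
  obtain ⟨g, hg, he⟩ := hf
  refine ⟨fun t => g (p t), hg.comp h.continuousOn h.mapsTo, fun _ ht => he _ (h.mapsTo ht), ?_⟩
  simp [h.zero_eq_one]

/-- With winding number zero the logarithm along the path takes equal values at `0` and `1`, so it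
descends to the curve. -/
theorem hasLogOn_of_hasWinding_zero [T2Space X] {f : X → ℂ} (hf : HasWinding p f 0) :
    HasLogOn f S := by
  obtain ⟨g, hg, he, h1⟩ := hf
  have h1' : g 1 = g 0 := by simpa using h1
  let G : X → ℂ := fun x => g (Function.invFunOn p (Ico 0 1) x)
  have hG : ∀ t ∈ Icc (0 : ℝ) 1, G (p t) = g t := by
    intro t ht
    rcases ht.2.lt_or_eq with h2 | rfl
    · simp only [G, h.injOn.leftInvOn_invFunOn ⟨ht.1, h2⟩]
    · simp only [G, ← h.zero_eq_one,
        h.injOn.leftInvOn_invFunOn (show (0 : ℝ) ∈ Ico 0 1 by simp), h1']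
  refine ⟨G, ?_, ?_⟩
  · rw [← h.image]
    exact isCompact_Icc.continuousOn_image h.continuousOn (hg.congr hG)
  · rw [← h.image]
    rintro _ ⟨t, ht, rfl⟩
    rw [hG t ht, he t ht]

end IsLoop

/-- A function on a graph can be prescribed along its edges. -/
theorem exists_function_of_edges [TopologicalSpace X] [T2Space X] {Y : Type*}
    [TopologicalSpace Y] {E : Set (Set X)}
    (hE : E.Finite) {V : Set X} {γ : Set X → ℝ → X} (hγ : ∀ e ∈ E, IsEdgeParam (γ e) e V)
    (hd : E.PairwiseDisjoint id) (hEV : ∀ e ∈ E, Disjoint e V) {u : Set X → ℝ → Y} {h : X → Y}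
    (hu : ∀ e ∈ E, ContinuousOn (u e) (Icc 0 1)) (h0 : ∀ e ∈ E, u e 0 = h (γ e 0))
    (h1 : ∀ e ∈ E, u e 1 = h (γ e 1)) :
    ∃ F : X → Y, ContinuousOn F (⋃ e ∈ E, closure e) ∧
      ∀ e ∈ E, ∀ t ∈ Icc (0 : ℝ) 1, F (γ e t) = u e t := by
  classical
  -- Off `V`, a point of an edge determines its edge and parameter uniquely. At the ends of edges
  -- the value comes from `h`, so several edges may share an end, or one edge may have equal ends.
  let c : X → Set X × ℝ := fun x =>
    Classical.epsilon fun q : Set X × ℝ => q.1 ∈ E ∧ q.2 ∈ Ioo (0 : ℝ) 1 ∧ γ q.1 q.2 = x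
  let F : X → Y := fun x => if x ∈ V then h x else u (c x).1 (c x).2
  have hF : ∀ e ∈ E, ∀ t ∈ Icc (0 : ℝ) 1, F (γ e t) = u e t := by
    intro e he t ht
    rcases ht.1.eq_or_lt with rfl | ht0
    · simp only [F, (hγ e he).zero_mem, if_true, h0 e he]
    rcases ht.2.eq_or_lt with rfl | ht1
    · simp only [F, (hγ e he).one_mem, if_true, h1 e he]
    have hte : γ e t ∈ e :=
      (hγ e he).image.subset (mem_image_of_mem _ (show t ∈ Ioo (0 : ℝ) 1 from ⟨ht0, ht1⟩))
    have hV : γ e t ∉ V := fun hV => (hEV e he).le_bot ⟨hte, hV⟩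
    obtain ⟨k1, k2, k3⟩ : (c (γ e t)).1 ∈ E ∧ (c (γ e t)).2 ∈ Ioo (0 : ℝ) 1 ∧
        γ (c (γ e t)).1 (c (γ e t)).2 = γ e t :=
      Classical.epsilon_spec (p := fun q : Set X × ℝ =>
        q.1 ∈ E ∧ q.2 ∈ Ioo (0 : ℝ) 1 ∧ γ q.1 q.2 = γ e t) ⟨(e, t), he, ⟨ht0, ht1⟩, rfl⟩
    have k4 : γ e t ∈ (c (γ e t)).1 := by
      rw [← (hγ _ k1).image]
      exact ⟨_, k2, k3⟩
    have k5 : (c (γ e t)).1 = e := hd.elim_set k1 he _ k4 hte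
    simp only [F, hV, if_false]
    rw [k5] at k3 ⊢
    rw [(hγ e he).injOn k2 (show t ∈ Ioo (0 : ℝ) 1 from ⟨ht0, ht1⟩) k3]
  refine ⟨F, ?_, hF⟩
  have : Finite E := hE
  rw [biUnion_eq_iUnion]
  refine (locallyFinite_of_finite _).continuousOn_iUnion (fun e => isClosed_closure) fun e => ?_
  rw [← (hγ e e.2).image_Icc]
  exact isCompact_Icc.continuousOn_image (hγ e e.2).continuousOn ((hu e e.2).congr (hF e e.2))

end Winding

/-! ### Functions on the skeleton and their logarithms. -/

namespace Tessellation

variable {X : Type*} [TopologicalSpace X] {ι : Type*} (T : Tessellation X ι)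

/-- The union of the boundaries of the tiles of a collection. -/
def skeleton (C : Finset ι) : Set X := ⋃ i ∈ C, frontier (T.tile i)

theorem skeleton_subset_region [T2Space X] (C : Finset ι) : T.skeleton C ⊆ T.region C :=
  iUnion₂_mono fun i _ => (T.isDisk i).frontier_subset

theorem frontier_tile_subset_skeleton {C : Finset ι} {i : ι} (hi : i ∈ C) :
    frontier (T.tile i) ⊆ T.skeleton C :=
  subset_biUnion_of_mem (u := fun i => frontier (T.tile i)) hi

variable [T2Space X] [ChartedSpace (EuclideanSpace ℝ (Fin 2)) X]

/-- Distinct tiles meet only in their frontiers, so agreement needs to be checked only there. -/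
theorem exists_glue_tiles {Y : Type*} [TopologicalSpace Y] [Nonempty Y] (C : Finset ι)
    (h : ι → X → Y) (hc : ∀ i ∈ C, ContinuousOn (h i) (T.tile i))
    (hag : ∀ i ∈ C, ∀ j ∈ C, i ≠ j → ∀ x ∈ frontier (T.tile i), x ∈ frontier (T.tile j) →
      h i x = h j x) :
    ∃ F : X → Y, ContinuousOn F (T.region C) ∧ ∀ i ∈ C, EqOn F (h i) (T.tile i) := by
  refine exists_glue C.finite_toSet (fun i _ => T.isClosed_tile i) h hc
    fun i hi j hj x hxi hxj => ?_
  by_cases hij : i = j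
  · rw [hij]
  · exact hag i hi j hj hij x (T.mem_frontier_tile hij hxi hxj)
      (T.mem_frontier_tile (Ne.symm hij) hxj hxi)

/-- A function on the skeleton that has a logarithm on the boundary of each tile has one on the
whole skeleton. -/
theorem hasLogOn_skeleton {C : Finset ι} (hC : T.IsConfiguration C) {f : X → ℂ}
    (hf : ∀ i ∈ C, HasLogOn f (frontier (T.tile i))) : HasLogOn f (T.skeleton C) := by
  have h1 : ∀ i ∈ C, ∃ g : X → ℂ, ContinuousOn g (T.tile i) ∧
      ∀ x ∈ frontier (T.tile i), Complex.exp (g x) = f x := by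
    intro i hi
    obtain ⟨g, hg, he⟩ := hf i hi
    obtain ⟨g', hg', he'⟩ := (T.isDisk i).isCompact.exists_extension isClosed_frontier
      (T.isDisk i).frontier_subset hg
    exact ⟨g', hg', fun x hx => by rw [he' hx, he x hx]⟩
  choose! g hg he using h1
  -- The logarithms of neighbouring tiles may differ by multiples of `2πi`; only their exponentials
  -- glue.
  obtain ⟨F, hF, hFe⟩ := T.exists_glue_tiles C (fun i x => Complex.exp (g i x))
    (fun i hi => (hg i hi).cexp)
    fun i hi j hj _ x hxi hxj => by rw [he i hi x hxi, he j hj x hxj]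
  have hlog : HasLogOn F (T.region C) := by
    refine hC.hasLogOn hF fun x hx => ?_
    obtain ⟨i, hi, hxi⟩ := T.mem_region.1 hx
    rw [hFe i hi hxi]
    exact Complex.exp_ne_zero _
  refine (hlog.mono (T.skeleton_subset_region C)).congr fun x hx => ?_
  obtain ⟨i, hi, hxi⟩ := mem_iUnion₂.1 hx
  rw [hFe i hi ((T.isDisk i).frontier_subset hxi)]
  exact (he i hi x hxi).symm

/-- The skeleton of a configuration is connected. -/
theorem skeleton_constant {C : Finset ι} (hC : T.IsConfiguration C) {k : X → ℤ}
    (hk : ContinuousOn k (T.skeleton C)) {x y : X} (hx : x ∈ T.skeleton C)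
    (hy : y ∈ T.skeleton C) : k x = k y := by
  have h1 : ∀ i ∈ C, ∃ n : ℤ, ∀ x ∈ frontier (T.tile i), k x = n := by
    intro i hi
    obtain ⟨z, hz⟩ := (T.isDisk i).frontier_nonempty
    exact ⟨k z, fun x hx => (T.isDisk i).isPreconnected_frontier.constant
      (hk.mono (T.frontier_tile_subset_skeleton hi)) hx hz⟩
  choose! n hn using h1
  -- The constants on the tile boundaries spread over the tiles, which reduces the claim to
  -- connectedness of the disk.
  obtain ⟨F, hF, hFe⟩ := T.exists_glue_tiles C (fun i _ => n i) (fun i _ => continuousOn_const)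
    fun i hi j hj _ x hxi hxj => by rw [← hn i hi x hxi, ← hn j hj x hxj]
  have hkF : ∀ x ∈ T.skeleton C, k x = F x := by
    intro x hx
    obtain ⟨i, hi, hxi⟩ := mem_iUnion₂.1 hx
    rw [hn i hi x hxi, hFe i hi ((T.isDisk i).frontier_subset hxi)]
  rw [hkF x hx, hkF y hy]
  exact hC.isPreconnected.constant hF (T.skeleton_subset_region C hx)
    (T.skeleton_subset_region C hy)

/-- For every tile of a configuration there is a function that winds around the boundary of this
tile, and of no other tile. -/
theorem exists_winding_function {C : Finset ι} (hC : T.IsConfiguration C) {i : ι} (hi : i ∈ C) :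
    ∃ f : X → ℂ, ContinuousOn f (T.region C) ∧ (∀ x ∈ T.skeleton C, f x ≠ 0) ∧
      (∀ j ∈ C, j ≠ i → HasLogOn f (frontier (T.tile j))) ∧
      ¬ HasLogOn f (frontier (T.tile i)) := by
  obtain ⟨φ, ψ, h⟩ := hC.exists_param
  obtain ⟨c, hc⟩ := (T.isDisk i).interior_nonempty
  have hci : c ∈ T.tile i := interior_subset hc
  have hsub : T.tile i ⊆ T.region C := fun x hx => T.mem_region.2 ⟨i, hi, hx⟩
  have hcC : c ∈ interior (T.region C) := interior_mono hsub hc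
  have hf0 : ∀ x ∈ T.region C, x ≠ c → ψ x - ψ c ≠ 0 := fun x hx hxc h0 =>
    hxc (h.injOn_inv hx (interior_subset hcC) (sub_eq_zero.1 h0))
  have hfc : ContinuousOn (fun x => ψ x - ψ c) (T.region C) :=
    h.continuousOn_inv.sub continuousOn_const
  have hcj : ∀ j, j ≠ i → c ∉ T.tile j := fun j hj hcj =>
    (T.mem_frontier_tile hj.symm hci hcj).2 hc
  have hdisk : ∀ j ∈ C, j ≠ i → ∀ x ∈ T.tile j, ψ x - ψ c ≠ 0 := fun j hj hji x hx =>
    hf0 x (T.mem_region.2 ⟨j, hj, hx⟩) fun hxc => hcj j hji (hxc ▸ hx)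
  refine ⟨fun x => ψ x - ψ c, hfc, fun x hx => ?_, fun j hj hji => ?_, ?_⟩
  · refine hf0 x (T.skeleton_subset_region C hx) ?_
    rintro rfl
    obtain ⟨j, hj, hxj⟩ := mem_iUnion₂.1 hx
    by_cases hji : j = i
    · subst hji
      exact hxj.2 hc
    · exact hcj j hji ((T.isDisk j).frontier_subset hxj)
  · refine HasLogOn.mono ?_ (T.isDisk j).frontier_subset
    exact (T.isDisk j).hasLogOn (hfc.mono fun x hx => T.mem_region.2 ⟨j, hj, hx⟩)
      (hdisk j hj hji)
  · rintro ⟨g, hg, he⟩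
    obtain ⟨g', hg', he'⟩ := (T.isDisk i).isCompact.exists_extension isClosed_frontier
      (T.isDisk i).frontier_subset hg
    classical
    -- A logarithm on the boundary of tile `i` would allow the zero at `c` to be removed without
    -- changing the values on the boundary of the configuration. Then `w - ψ c` would have a
    -- logarithm on the unit circle, and so would `w`, since `(w - ψ c) / w` stays in the slit
    -- plane.
    obtain ⟨F, hF, hFe⟩ := T.exists_glue_tiles C
      (fun j => if j = i then fun x => Complex.exp (g' x) else fun x => ψ x - ψ c)
      (fun j hj => by
        by_cases hji : j = i
        · subst hji
          simpa using hg'.cexp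
        · simpa [hji] using hfc.mono fun x hx => T.mem_region.2 ⟨j, hj, hx⟩)
      (by
        have key : ∀ j : ι, ∀ x ∈ frontier (T.tile j),
            (if j = i then fun x => Complex.exp (g' x) else fun x => ψ x - ψ c) x
              = ψ x - ψ c := by
          intro j x hx
          by_cases hji : j = i
          · subst hji
            simp only [if_true]
            rw [he' hx, he x hx]
          · simp only [hji, if_false]
        intro j _ k _ _ x hxj hxk
        rw [key j x hxj, key k x hxk])
    have hF0 : ∀ x ∈ T.region C, F x ≠ 0 := by
      intro x hx
      obtain ⟨j, hj, hxj⟩ := T.mem_region.1 hx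
      rw [hFe j hj hxj]
      by_cases hji : j = i
      · simp [hji]
      · simpa only [hji, if_false] using hdisk j hj hji x hxj
    have hFb : ∀ x ∈ frontier (T.region C), F x = ψ x - ψ c := by
      intro x hx
      obtain ⟨j, hj, hxj⟩ := T.mem_region.1 (hC.frontier_subset hx)
      rw [hFe j hj hxj]
      by_cases hji : j = i
      · subst hji
        have hxF : x ∈ frontier (T.tile j) :=
          ⟨subset_closure hxj, fun hx' => hx.2 (interior_mono hsub hx')⟩
        simp only [if_true]
        rw [he' hxF, he x hxF]
      · simp only [hji, if_false]
    have hm : MapsTo φ (sphere 0 1) (frontier (T.region C)) := by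
      rw [h.frontier_eq]
      exact mapsTo_image _ _
    have hcirc : HasLogOn (fun w => w - ψ c) (sphere (0 : ℂ) 1) := by
      refine (((hC.hasLogOn hF hF0).mono hC.frontier_subset).comp
        (h.continuousOn.mono sphere_subset_closedBall) hm).congr fun w hw => ?_
      simp only
      rw [hFb _ (hm hw), h.left_inv w (sphere_subset_closedBall hw)]
    have hlt := h.norm_lt_one hcC
    have hw1 : ∀ w ∈ sphere (0 : ℂ) 1, ‖w‖ = 1 := fun w hw => by simpa using hw
    have hw0 : ∀ w ∈ sphere (0 : ℂ) 1, w ≠ 0 := fun w hw h0 => by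
      have := hw1 w hw
      simp [h0] at this
    have hq : HasLogOn (fun w => (w - ψ c) / w) (sphere (0 : ℂ) 1) := by
      refine HasLogOn.of_slitPlane ((continuousOn_id.sub continuousOn_const).div continuousOn_id
        hw0) fun w hw => sub_mem_slitPlane (hw0 w hw) ?_
      rw [hw1 w hw]
      exact hlt
    refine not_hasLogOn_odd (f := fun w => w) (fun w _ => rfl) ((hcirc.div hq).congr fun w hw => ?_)
    have h1 := hw0 w hw
    have h2 : w - ψ c ≠ 0 := by
      intro h0
      have := hw1 w hw
      rw [sub_eq_zero.1 h0] at this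
      exact hlt.ne this
    simp only
    field_simp

end Tessellation

/-! ### Integer cochains of a configuration and Euler's formula. -/

namespace Tessellation

variable {X : Type*} [TopologicalSpace X] {ι : Type*} (T : Tessellation X ι)

/-- The vertices in the region covered by a collection of tiles. -/
def vertices (C : Finset ι) : Set X := T.vertex ∩ T.region C

theorem disjoint_vertex_of_mem_edges {C : Finset ι} {e : Set X} (he : e ∈ T.edges C) :
    Disjoint e T.vertex := by
  obtain ⟨i, -, hi⟩ := mem_iUnion₂.1 he
  exact disjoint_sdiff_left.mono_left (subset_of_mem_edgesOf hi)

variable [T2Space X] [ChartedSpace (EuclideanSpace ℝ (Fin 2)) X]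

theorem vertices_subset_skeleton (C : Finset ι) : T.vertices C ⊆ T.skeleton C := by
  rintro x ⟨hxV, hx⟩
  obtain ⟨i, hi, hxi⟩ := T.mem_region.1 hx
  exact T.frontier_tile_subset_skeleton hi (T.mem_frontier_of_mem_vertex hxV hxi)

theorem finite_vertices (C : Finset ι) : (T.vertices C).Finite := by
  refine (C.finite_toSet.biUnion fun i _ => T.finite_vertex i).subset ?_
  rintro x ⟨hxV, hx⟩
  obtain ⟨i, hi, hxi⟩ := T.mem_region.1 hx
  exact mem_biUnion (show i ∈ (C : Set ι) from hi) ⟨hxV, T.mem_frontier_of_mem_vertex hxV hxi⟩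

/-- If edges of tiles `i ≠ j` share a point, both are the component at that point of the vertex-free
part of the intersection of the two tiles. -/
theorem edges_pairwiseDisjoint (C : Finset ι) : (T.edges C).PairwiseDisjoint id := by
  intro e he e' he' hne
  rw [Function.onFun, Set.disjoint_left]
  intro x hx hx'
  obtain ⟨i, -, hi⟩ := mem_iUnion₂.1 he
  obtain ⟨j, -, hj⟩ := mem_iUnion₂.1 he'
  refine hne ?_
  have hxi := subset_of_mem_edgesOf hi hx
  have hxj := subset_of_mem_edgesOf hj hx'
  rw [id, eq_of_mem_edgesOf hi hx] at *
  rw [eq_of_mem_edgesOf hj hx']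
  by_cases hij : i = j
  · rw [hij]
  have hti := (T.isDisk i).frontier_subset hxi.1
  have htj := (T.isDisk j).frontier_subset hxj.1
  have h1 := T.connectedComponentIn_frontier_region (C := {i}) (by simp)
    (by simpa using Ne.symm hij) hti htj hxi.2
  have h2 := T.connectedComponentIn_frontier_region (C := {j}) (by simp)
    (by simpa using hij) htj hti hxi.2
  rw [T.region_singleton] at h1 h2
  rw [h1, h2, inter_comm]

theorem iUnion_closure_edges (C : Finset ι) : ⋃ e ∈ T.edges C, closure e = T.skeleton C := by
  apply Subset.antisymm
  · refine iUnion₂_subset fun e he => ?_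
    obtain ⟨i, hi, hie⟩ := mem_iUnion₂.1 he
    exact (closure_minimal ((subset_of_mem_edgesOf hie).trans sdiff_subset)
      isClosed_frontier).trans (T.frontier_tile_subset_skeleton hi)
  · refine iUnion₂_subset fun i hi x hx => ?_
    obtain ⟨e, he, hxe⟩ := (T.edgesOf_tile_spec i).2.2.2 x hx
    exact mem_biUnion (show e ∈ T.edges C from mem_biUnion (show i ∈ C from hi) he) hxe

/-- `γ` parametrises all edges of the tiles in `C`. -/
def IsEdgeSystem (C : Finset ι) (γ : Set X → ℝ → X) : Prop :=
  ∀ e ∈ T.edges C, IsEdgeParam (γ e) e T.vertex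

theorem exists_isEdgeSystem [Nonempty X] (C : Finset ι) : ∃ γ, T.IsEdgeSystem C γ := by
  have : ∀ e ∈ T.edges C, ∃ γ, IsEdgeParam γ e T.vertex := fun e he => by
    obtain ⟨i, -, hie⟩ := mem_iUnion₂.1 he
    exact (T.edgesOf_tile_spec i).2.2.1 e hie
  choose! γ hγ using this
  exact ⟨γ, hγ⟩

namespace IsEdgeSystem

variable {T} {C : Finset ι} {γ : Set X → ℝ → X} (hγ : T.IsEdgeSystem C γ)
include hγ

theorem mapsTo {e : Set X} (he : e ∈ T.edges C) : MapsTo (γ e) (Icc 0 1) (T.skeleton C) := by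
  intro t ht
  rw [← T.iUnion_closure_edges C]
  exact mem_biUnion he ((hγ e he).image_Icc ▸ mem_image_of_mem (γ e) ht)

theorem exists_of_mem_skeleton {x : X} (hx : x ∈ T.skeleton C) :
    ∃ e ∈ T.edges C, ∃ t ∈ Icc (0 : ℝ) 1, γ e t = x := by
  rw [← T.iUnion_closure_edges C] at hx
  obtain ⟨e, he, hxe⟩ := mem_iUnion₂.1 hx
  rw [← (hγ e he).image_Icc] at hxe
  obtain ⟨t, ht, h⟩ := hxe
  exact ⟨e, he, t, ht, h⟩

theorem exists_of_mem_vertices {v : X} (hv : v ∈ T.vertices C) :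
    ∃ e ∈ T.edges C, γ e 0 = v ∨ γ e 1 = v := by
  obtain ⟨e, he, t, ht, rfl⟩ := hγ.exists_of_mem_skeleton (T.vertices_subset_skeleton C hv)
  refine ⟨e, he, ?_⟩
  rcases ht.1.eq_or_lt with rfl | ht0
  · exact Or.inl rfl
  rcases ht.2.eq_or_lt with rfl | ht1
  · exact Or.inr rfl
  have : γ e t ∈ e :=
    (hγ e he).image.subset (mem_image_of_mem _ (show t ∈ Ioo (0 : ℝ) 1 from ⟨ht0, ht1⟩))
  exact absurd hv.1 (Set.disjoint_left.1 (T.disjoint_vertex_of_mem_edges he) this)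

theorem zero_mem {e : Set X} (he : e ∈ T.edges C) : γ e 0 ∈ T.vertices C :=
  ⟨(hγ e he).zero_mem, T.skeleton_subset_region C (hγ.mapsTo he (by simp))⟩

theorem one_mem {e : Set X} (he : e ∈ T.edges C) : γ e 1 ∈ T.vertices C :=
  ⟨(hγ e he).one_mem, T.skeleton_subset_region C (hγ.mapsTo he (by simp))⟩

theorem exists_function {Y : Type*} [TopologicalSpace Y] {u : Set X → ℝ → Y} {h : X → Y}
    (hu : ∀ e ∈ T.edges C, ContinuousOn (u e) (Icc 0 1))
    (h0 : ∀ e ∈ T.edges C, u e 0 = h (γ e 0)) (h1 : ∀ e ∈ T.edges C, u e 1 = h (γ e 1)) :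
    ∃ F : X → Y, ContinuousOn F (T.skeleton C) ∧
      ∀ e ∈ T.edges C, ∀ t ∈ Icc (0 : ℝ) 1, F (γ e t) = u e t := by
  rw [← T.iUnion_closure_edges C]
  exact exists_function_of_edges (T.finite_edges C) hγ (T.edges_pairwiseDisjoint C)
    (fun e he => T.disjoint_vertex_of_mem_edges he) hu h0 h1

end IsEdgeSystem

/-- `f` is a function on the skeleton that winds `c e` times around `0` along the edge `e`. -/
def IsEdgeCharacter (C : Finset ι) (γ : Set X → ℝ → X) (c : Set X → ℤ) (f : X → ℂ) : Prop :=
  ContinuousOn f (T.skeleton C) ∧ ∀ e ∈ T.edges C, ∀ t ∈ Icc (0 : ℝ) 1,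
    f (γ e t) = Complex.exp (c e * t * (2 * π * Complex.I))

namespace IsEdgeSystem

variable {T} {C : Finset ι} {γ : Set X → ℝ → X} (hγ : T.IsEdgeSystem C γ)
include hγ

theorem exists_isEdgeCharacter (c : Set X → ℤ) : ∃ f, T.IsEdgeCharacter C γ c f := by
  refine hγ.exists_function (h := fun _ => 1) (fun e _ => ?_) (fun e _ => by simp) fun e _ => ?_
  · exact Continuous.continuousOn (by fun_prop)
  · simp [Complex.exp_int_mul_two_pi_mul_I]

theorem ne_zero {c : Set X → ℤ} {f : X → ℂ} (hf : T.IsEdgeCharacter C γ c f) {x : X}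
    (hx : x ∈ T.skeleton C) : f x ≠ 0 := by
  obtain ⟨e, he, t, ht, rfl⟩ := hγ.exists_of_mem_skeleton hx
  rw [hf.2 e he t ht]
  exact Complex.exp_ne_zero _

theorem eq_one {c : Set X → ℤ} {f : X → ℂ} (hf : T.IsEdgeCharacter C γ c f) {v : X}
    (hv : v ∈ T.vertices C) : f v = 1 := by
  obtain ⟨e, he, rfl | rfl⟩ := hγ.exists_of_mem_vertices hv
  · simp [hf.2 e he 0 (by simp)]
  · rw [hf.2 e he 1 (by simp)]
    simp [Complex.exp_int_mul_two_pi_mul_I]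

theorem eqOn_mul {c c' c'' : Set X → ℤ} {f f' f'' : X → ℂ} (hf : T.IsEdgeCharacter C γ c f)
    (hf' : T.IsEdgeCharacter C γ c' f') (hf'' : T.IsEdgeCharacter C γ c'' f'')
    (h : ∀ e ∈ T.edges C, c'' e = c e + c' e) :
    EqOn (fun x => f x * f' x) f'' (T.skeleton C) := by
  intro x hx
  obtain ⟨e, he, t, ht, rfl⟩ := hγ.exists_of_mem_skeleton hx
  simp only [hf.2 e he t ht, hf'.2 e he t ht, hf''.2 e he t ht, ← Complex.exp_add, h e he]
  push_cast
  ring_nf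

/-- A function with prescribed winding along the edges has a logarithm if and only if the winding
numbers form a coboundary. -/
theorem hasLogOn_iff {c : Set X → ℤ} {f : X → ℂ} (hf : T.IsEdgeCharacter C γ c f) :
    HasLogOn f (T.skeleton C) ↔ ∃ h : X → ℤ, ∀ e ∈ T.edges C, c e = h (γ e 1) - h (γ e 0) := by
  constructor
  · rintro ⟨g, hg, he⟩
    -- Since `f` is `1` at the vertices, a logarithm takes values in `2πiℤ` there. These integers
    -- are the potential `h`, and the increment along `e` is `c e`.
    have h1 : ∀ v ∈ T.vertices C, ∃ n : ℤ, g v = n * (2 * π * Complex.I) := by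
      intro v hv
      rw [← Complex.exp_eq_one_iff, he v (T.vertices_subset_skeleton C hv), hγ.eq_one hf hv]
    choose! n hn using h1
    refine ⟨n, fun e hee => ?_⟩
    obtain ⟨k, hk⟩ := exp_eq_exp_preconnected isPreconnected_Icc (g := fun t => g (γ e t))
      (g' := fun t : ℝ => (c e : ℂ) * t * (2 * π * Complex.I))
      (hg.comp (hγ e hee).continuousOn (hγ.mapsTo hee))
      (Continuous.continuousOn (by fun_prop)) fun t ht => by
        rw [he _ (hγ.mapsTo hee ht), hf.2 e hee t ht]
    have e0 := hk 0 (by simp)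
    have e1 := hk 1 (by simp)
    simp only [hn _ (hγ.zero_mem hee), hn _ (hγ.one_mem hee)] at e0 e1
    push_cast at e0 e1
    have : (c e : ℂ) = ((n (γ e 1) - n (γ e 0) : ℤ) : ℂ) := by
      apply mul_right_cancel₀ Complex.two_pi_I_ne_zero
      push_cast
      linear_combination e0 - e1
    exact_mod_cast this
  · rintro ⟨h, hh⟩
    obtain ⟨g, hg, hge⟩ := hγ.exists_function
      (u := fun e t => (h (γ e 0) + c e * t : ℂ) * (2 * π * Complex.I))
      (h := fun v => h v * (2 * π * Complex.I))
      (fun e _ => Continuous.continuousOn (by fun_prop)) (fun e _ => by simp)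
      (fun e he => by simp [hh e he])
    refine ⟨g, hg, fun x hx => ?_⟩
    obtain ⟨e, he, t, ht, rfl⟩ := hγ.exists_of_mem_skeleton hx
    rw [hge e he t ht, hf.2 e he t ht, add_mul, Complex.exp_add,
      Complex.exp_int_mul_two_pi_mul_I, one_mul]

/-- Up to functions with a logarithm, each nonvanishing function on the skeleton is given by its
winding along the edges. -/
theorem exists_isEdgeCharacter_div (hC : T.IsConfiguration C) {f : X → ℂ}
    (hfc : ContinuousOn f (T.skeleton C)) (h0 : ∀ x ∈ T.skeleton C, f x ≠ 0) :
    ∃ c f', T.IsEdgeCharacter C γ c f' ∧ HasLogOn (fun x => f x / f' x) (T.skeleton C) := by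
  -- Dividing by `exp w` makes the function equal to `1` at all vertices, so that its winding along
  -- each edge is an integer.
  obtain ⟨w, hw, hwe⟩ := hC.isCompact.exists_extension (T.finite_vertices C).isClosed
    inter_subset_right ((T.finite_vertices C).continuousOn fun v => Complex.log (f v))
  have hwv : ∀ v ∈ T.vertices C, Complex.exp (w v) = f v := fun v hv => by
    rw [hwe hv, Complex.exp_log (h0 v (T.vertices_subset_skeleton C hv))]
  have hws := hw.mono (T.skeleton_subset_region C)
  have h1 : ∀ e ∈ T.edges C, ∃ a : ℝ → ℂ, ContinuousOn a (Icc 0 1) ∧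
      (∀ t ∈ Icc (0 : ℝ) 1, Complex.exp (a t) = f (γ e t) / Complex.exp (w (γ e t))) ∧
      ∃ n : ℤ, a 1 = a 0 + n * (2 * π * Complex.I) := by
    intro e he
    have hm := hγ.mapsTo he
    have hc := (hγ e he).continuousOn
    obtain ⟨a, ha, hae⟩ := HasLogOn.Icc ((hfc.comp hc hm).div (hws.comp hc hm).cexp
      fun t _ => Complex.exp_ne_zero _)
      fun t ht => div_ne_zero (h0 _ (hm ht)) (Complex.exp_ne_zero _)
    refine ⟨a, ha, hae, exists_int_of_exp_eq_exp ?_⟩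
    have k0 := h0 _ (hm (show (0 : ℝ) ∈ Icc 0 1 by simp))
    have k1 := h0 _ (hm (show (1 : ℝ) ∈ Icc 0 1 by simp))
    rw [hae 0 (by simp), hae 1 (by simp)]
    simp only [Pi.div_apply, Function.comp, hwv _ (hγ.zero_mem he), hwv _ (hγ.one_mem he),
      div_self k0, div_self k1]
  choose! a ha hae c hc using h1
  obtain ⟨f', hf'⟩ := hγ.exists_isEdgeCharacter c
  -- Along each edge the logarithm is compared with the linear one of the same total increment. The
  -- term `a e 0`, a multiple of `2πi`, is subtracted so that the difference vanishes at both ends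
  -- and the edges fit together.
  obtain ⟨g, hg, hge⟩ := hγ.exists_function (h := fun _ => 0)
    (u := fun e t => a e t - a e 0 - c e * t * (2 * π * Complex.I))
    (fun e he => ((ha e he).sub continuousOn_const).sub (Continuous.continuousOn (by fun_prop)))
    (fun e he => by simp) (fun e he => by simp [hc e he])
  refine ⟨c, f', hf', fun x => g x + w x, hg.add hws, fun x hx => ?_⟩
  obtain ⟨e, he, t, ht, rfl⟩ := hγ.exists_of_mem_skeleton hx
  have k0 := h0 _ (hγ.mapsTo he (show (0 : ℝ) ∈ Icc 0 1 by simp))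
  have hz : Complex.exp (a e 0) = 1 := by
    rw [hae e he 0 (by simp), hwv _ (hγ.zero_mem he), div_self k0]
  simp only
  rw [hge e he t ht, hf'.2 e he t ht, Complex.exp_add, Complex.exp_sub, Complex.exp_sub, hz,
    hae e he t ht]
  field_simp

end IsEdgeSystem

/-- **Euler's formula** for a configuration. -/
theorem ncard_edges_add_one {C : Finset ι} (hC : T.IsConfiguration C) :
    (T.edges C).ncard + 1 = (T.vertices C).ncard + C.card := by
  classical
  obtain ⟨b, hbV, hbF⟩ := T.boundaryVertices_nonempty hC
  have hbC : b ∈ T.vertices C := ⟨hbV, hC.frontier_subset hbF⟩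
  have : Nonempty X := ⟨b⟩
  obtain ⟨γ, hγ⟩ := T.exists_isEdgeSystem C
  have := (T.finite_edges C).fintype
  have := (T.finite_vertices C).fintype
  let δ : (T.vertices C → ℤ) →ₗ[ℤ] (T.edges C → ℤ) := LinearMap.pi fun e =>
    LinearMap.proj ⟨γ e 1, hγ.one_mem e.2⟩ - LinearMap.proj ⟨γ e 0, hγ.zero_mem e.2⟩
  have hδ : ∀ h e, δ h e = h ⟨γ e 1, hγ.one_mem e.2⟩ - h ⟨γ e 0, hγ.zero_mem e.2⟩ :=
    fun h e => rfl
  have hloop : ∀ i, ∃ p, IsLoop p (frontier (T.tile i)) := fun i => by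
    obtain ⟨v, hv⟩ := (T.isDisk i).frontier_nonempty
    obtain ⟨p, hp, -⟩ := (T.isDisk i).exists_isLoop hv
    exact ⟨p, hp⟩
  choose p hp using hloop
  let ext : (T.edges C → ℤ) → Set X → ℤ := fun c => Function.extend Subtype.val c 0
  have hext : ∀ c (e : T.edges C), ext c e = c e := fun c e =>
    Subtype.val_injective.extend_apply _ _ _
  choose f hf using fun c => hγ.exists_isEdgeCharacter (ext c)
  have hfsub : ∀ i : C, frontier (T.tile i) ⊆ T.skeleton C := fun i =>
    T.frontier_tile_subset_skeleton i.2
  choose w hw using fun c (i : C) => (hp i).exists_hasWinding ((hf c).1.mono (hfsub i))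
    fun x hx => hγ.ne_zero (hf c) (hfsub i hx)
  -- Additivity holds because winding numbers are unique and the function for `c + c'` is the
  -- product of those for `c` and `c'`.
  let ω : (T.edges C → ℤ) →ₗ[ℤ] (C → ℤ) := (AddMonoidHom.mk' w fun c c' => by
    ext i
    refine (hw (c + c') i).unique ((hp i).hasWinding_congr (EqOn.mono (hfsub i) ?_)
      ((hw c i).mul (hw c' i)))
    exact hγ.eqOn_mul (hf c) (hf c') (hf (c + c')) fun e he => by
      rw [hext _ ⟨e, he⟩, hext _ ⟨e, he⟩, hext _ ⟨e, he⟩, Pi.add_apply]).toIntLinearMap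
  have hω : ∀ c i, ω c i = 0 ↔ HasLogOn (f c) (frontier (T.tile i)) := by
    intro c i
    constructor
    · intro h
      have h' : w c i = 0 := h
      exact (hp i).hasLogOn_of_hasWinding_zero (h' ▸ hw c i)
    · intro h
      exact (hw c i).unique ((hp i).hasWinding_zero_of_hasLogOn h)
  have hexact : LinearMap.ker ω = LinearMap.range δ := by
    ext c
    rw [LinearMap.mem_ker, LinearMap.mem_range]
    have h1 : ω c = 0 ↔ HasLogOn (f c) (T.skeleton C) := by
      constructor
      · intro h
        exact T.hasLogOn_skeleton hC fun i hi => (hω c ⟨i, hi⟩).1 (congrFun h ⟨i, hi⟩)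
      · intro h
        ext i
        exact (hω c i).2 (h.mono (hfsub i))
    rw [h1, hγ.hasLogOn_iff (hf c)]
    constructor
    · rintro ⟨h, hh⟩
      refine ⟨fun v => h v, ?_⟩
      ext e
      rw [hδ, ← hh e e.2, hext]
    · rintro ⟨h, rfl⟩
      refine ⟨Function.extend Subtype.val h 0, fun e he => ?_⟩
      have k1 := Subtype.val_injective.extend_apply h 0 ⟨γ e 1, hγ.one_mem he⟩
      have k0 := Subtype.val_injective.extend_apply h 0 ⟨γ e 0, hγ.zero_mem he⟩
      rw [hext _ ⟨e, he⟩, hδ, k0, k1]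
  have hkerδ : Module.finrank ℤ (LinearMap.ker δ) = 1 := by
    let κ : ℤ →ₗ[ℤ] (T.vertices C → ℤ) := LinearMap.pi fun _ => LinearMap.id
    have hκ : LinearMap.ker δ = LinearMap.range κ := by
      ext h
      rw [LinearMap.mem_ker, LinearMap.mem_range]
      constructor
      · intro h0
        have h0' : ∀ e (he : e ∈ T.edges C),
            h ⟨γ e 1, hγ.one_mem he⟩ = h ⟨γ e 0, hγ.zero_mem he⟩ := fun e he =>
          sub_eq_zero.1 (congrFun h0 ⟨e, he⟩)
        let h' : X → ℤ := Function.extend Subtype.val h 0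
        have hh' : ∀ v : T.vertices C, h' v = h v := fun v =>
          Subtype.val_injective.extend_apply h 0 v
        -- A cochain killed by `δ` extends to a function constant along each edge, which is
        -- continuous on the connected skeleton.
        obtain ⟨F, hF, hFe⟩ := hγ.exists_function (u := fun e _ => h' (γ e 0)) (h := h')
          (fun e _ => continuousOn_const) (fun e _ => rfl) fun e he => by
            rw [hh' ⟨_, hγ.zero_mem he⟩, hh' ⟨_, hγ.one_mem he⟩, h0' e he]
        have hFv : ∀ v (hv : v ∈ T.vertices C), F v = h ⟨v, hv⟩ := by
          intro v hv
          obtain ⟨e, he, rfl | rfl⟩ := hγ.exists_of_mem_vertices hv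
          · rw [hFe e he 0 (by simp), hh' ⟨_, hγ.zero_mem he⟩]
          · rw [hFe e he 1 (by simp), hh' ⟨_, hγ.zero_mem he⟩, h0' e he]
        refine ⟨h ⟨b, hbC⟩, ?_⟩
        ext v
        change h ⟨b, hbC⟩ = h v
        rw [← hFv b hbC, ← hFv v v.2]
        exact T.skeleton_constant hC hF (T.vertices_subset_skeleton C hbC)
          (T.vertices_subset_skeleton C v.2)
      · rintro ⟨n, rfl⟩
        ext e
        rw [hδ]
        exact sub_self n
    rw [hκ, LinearMap.finrank_range_of_inj fun n m h => congrFun h ⟨b, hbC⟩, Module.finrank_self]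
  have hrangeω : Module.finrank ℤ (LinearMap.range ω) = C.card := by
    apply le_antisymm
    · refine (Submodule.finrank_le _).trans ?_
      rw [Module.finrank_fintype_fun_eq_card, Fintype.card_coe]
    -- These cochains have diagonal image under `ω`. Nonzero diagonal entries suffice, because only
    -- the rank over `ℤ` matters.
    · have h1 : ∀ i : C, ∃ c, ω c i ≠ 0 ∧ ∀ j, j ≠ i → ω c j = 0 := by
        intro i
        obtain ⟨u, huc, hu0, huj, hui⟩ := T.exists_winding_function hC i.2
        obtain ⟨c', f', hf', hlog⟩ := hγ.exists_isEdgeCharacter_div hC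
          (huc.mono (T.skeleton_subset_region C)) hu0
        let c : T.edges C → ℤ := fun e => c' e
        have hff : EqOn (f c) f' (T.skeleton C) := by
          intro x hx
          obtain ⟨e, he, t, ht, rfl⟩ := hγ.exists_of_mem_skeleton hx
          rw [(hf c).2 e he t ht, hf'.2 e he t ht, hext c ⟨e, he⟩]
        have hiff : ∀ j : C, ω c j = 0 ↔ HasLogOn u (frontier (T.tile j)) := by
          intro j
          rw [hω]
          have hl := hlog.mono (hfsub j)
          constructor
          · intro h
            refine (hl.mul h).congr fun x hx => ?_
            simp only [hff (hfsub j hx)]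
            rw [div_mul_cancel₀ _ (hγ.ne_zero hf' (hfsub j hx))]
          · intro h
            refine (h.div hl).congr fun x hx => ?_
            have := hu0 x (hfsub j hx)
            have := hγ.ne_zero hf' (hfsub j hx)
            simp only [hff (hfsub j hx)]
            field_simp
        refine ⟨c, fun h => hui ((hiff i).1 h), fun j hj => (hiff j).2 (huj j j.2 ?_)⟩
        exact fun h => hj (Subtype.ext h)
      choose c hci hcj using h1
      have hli : LinearIndependent ℤ fun i : C =>
          (⟨ω (c i), LinearMap.mem_range_self ω (c i)⟩ : LinearMap.range ω) := by
        apply LinearIndependent.of_comp (LinearMap.range ω).subtype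
        rw [Fintype.linearIndependent_iff]
        intro a ha i
        have h2 := congrFun ha i
        rw [Finset.sum_apply, Finset.sum_eq_single i] at h2
        · exact (mul_eq_zero.1 h2).resolve_right (hci i)
        · intro j _ hj
          change a j * ω (c j) i = 0
          rw [hcj j i (Ne.symm hj), mul_zero]
        · simp
      have := hli.fintype_card_le_finrank
      rwa [Fintype.card_coe] at this
  -- Rank-nullity for both maps: `V = rank δ + 1` and `E = F + rank δ`.
  have r1 := (LinearMap.ker δ).finrank_quotient_add_finrank
  have r2 := (LinearMap.ker ω).finrank_quotient_add_finrank
  rw [δ.quotKerEquivRange.finrank_eq] at r1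
  rw [ω.quotKerEquivRange.finrank_eq] at r2
  rw [hkerδ, Module.finrank_fintype_fun_eq_card, ← Nat.card_eq_fintype_card,
    Nat.card_coe_set_eq] at r1
  rw [hexact, hrangeω, Module.finrank_fintype_fun_eq_card, ← Nat.card_eq_fintype_card,
    Nat.card_coe_set_eq] at r2
  omega

end Tessellation

/-! ### Angle sums and the two conclusions. -/

namespace Tessellation

variable {X : Type*} [TopologicalSpace X] {ι : Type*} (T : Tessellation X ι)

open Classical in
theorem configurationAngle_eq (C : Finset ι) (x : X) :
    T.configurationAngle C x = {i ∈ C | x ∈ T.tile i}.card * (2 * π / T.valence x) := by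
  rw [configurationAngle, Finset.sum_const, nsmul_eq_mul, valenceAngle]

theorem valence_pos (x : X) : 0 < T.valence x := by
  obtain ⟨i, hi⟩ := T.exists_mem_tile x
  exact (ncard_pos (T.finite_tiles_at x)).2 ⟨i, hi⟩

/-- The tiles at an interior point of a configuration take up the full angle. -/
theorem configurationAngle_of_forall_mem {C : Finset ι} {x : X}
    (h : ∀ i, x ∈ T.tile i → i ∈ C) : T.configurationAngle C x = 2 * π := by
  classical
  have hq : ({i ∈ C | x ∈ T.tile i}.card : ℝ) = T.valence x := by
    rw [valence, ← ncard_coe_finset]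
    congr 2
    ext i
    simpa using h i
  have := T.valence_pos x
  rw [T.configurationAngle_eq, hq]
  field_simp

theorem boundaryVertices_subset_vertices [T2Space X] (C : Finset ι) :
    T.boundaryVertices C ⊆ T.vertices C :=
  inter_subset_inter_right _ (T.isClosed_region C).frontier_subset

variable [T2Space X] [ChartedSpace (EuclideanSpace ℝ (Fin 2)) X]

/-- At a boundary point at least one tile belongs to `C` and at least one does not, so `0 < k < q`.
-/
theorem configurationAngle_mem_Ioo {C : Finset ι} {x : X} (hx : x ∈ frontier (T.region C)) :
    T.configurationAngle C x ∈ Ioo 0 (2 * π) := by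
  classical
  obtain ⟨⟨i, hi, hxi⟩, j, hj, hxj⟩ := T.mem_frontier_region.1 hx
  have hk : 0 < {i ∈ C | x ∈ T.tile i}.card :=
    Finset.card_pos.2 ⟨i, Finset.mem_filter.2 ⟨hi, hxi⟩⟩
  have hkq : {i ∈ C | x ∈ T.tile i}.card < T.valence x := by
    rw [valence, ← ncard_coe_finset]
    refine ncard_lt_ncard ⟨fun k hk => (Finset.mem_filter.1 hk).2, fun h => ?_⟩
      (T.finite_tiles_at x)
    exact hj (Finset.mem_filter.1 (h hxj)).1
  have hq : (0 : ℝ) < T.valence x := by exact_mod_cast T.valence_pos x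
  have hk' : (0 : ℝ) < {i ∈ C | x ∈ T.tile i}.card := by exact_mod_cast hk
  have hkq' : ({i ∈ C | x ∈ T.tile i}.card : ℝ) < T.valence x := by exact_mod_cast hkq
  rw [T.configurationAngle_eq]
  refine ⟨by positivity, ?_⟩
  rw [mul_div_assoc', div_lt_iff₀ hq, mul_comm]
  exact mul_lt_mul_of_pos_left hkq' (by positivity)

/-- Both sides sum the valence angle over the incidences of a vertex with a tile of `C`. -/
theorem sum_tileVertices_valenceAngle (C : Finset ι) :
    ∑ i ∈ C, ∑ᶠ x ∈ T.tileVertices i, T.valenceAngle x =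
      ∑ x ∈ (T.finite_vertices C).toFinset, T.configurationAngle C x := by
  classical
  have h1 : ∀ i ∈ C, ∑ᶠ x ∈ T.tileVertices i, T.valenceAngle x =
      ∑ x ∈ (T.finite_vertices C).toFinset, if x ∈ T.tile i then T.valenceAngle x else 0 := by
    intro i hi
    rw [finsum_mem_eq_finite_toFinset_sum _
      (show (T.tileVertices i).Finite from T.finite_vertex i), ← Finset.sum_filter]
    refine Finset.sum_congr ?_ fun _ _ => rfl
    ext x
    simp only [Finite.mem_toFinset, Finset.mem_filter]
    constructor
    · rintro ⟨hxV, hx⟩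
      have hxi := (T.isDisk i).frontier_subset hx
      exact ⟨⟨hxV, T.mem_region.2 ⟨i, hi, hxi⟩⟩, hxi⟩
    · rintro ⟨⟨hxV, -⟩, hxi⟩
      exact ⟨hxV, T.mem_frontier_of_mem_vertex hxV hxi⟩
  rw [Finset.sum_congr rfl h1, Finset.sum_comm]
  refine Finset.sum_congr rfl fun x _ => ?_
  rw [configurationAngle, Finset.sum_filter]

theorem sum_vertices_configurationAngle (C : Finset ι) :
    ∑ x ∈ (T.finite_vertices C).toFinset, T.configurationAngle C x =
      (∑ᶠ x ∈ T.boundaryVertices C, T.configurationAngle C x) +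
        ((T.vertices C).ncard - (T.boundaryVertices C).ncard : ℝ) * (2 * π) := by
  classical
  have hsub : (T.boundaryVertices_finite C).toFinset ⊆ (T.finite_vertices C).toFinset :=
    Finite.toFinset_subset_toFinset.2 (T.boundaryVertices_subset_vertices C)
  rw [finsum_mem_eq_finite_toFinset_sum _ (T.boundaryVertices_finite C),
    ← Finset.sum_sdiff hsub, add_comm]
  congr 1
  rw [Finset.sum_congr rfl fun x hx => ?_, Finset.sum_const, nsmul_eq_mul,
    Finset.card_sdiff_of_subset hsub, Nat.cast_sub (Finset.card_le_card hsub),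
    ncard_eq_toFinset_card _ (T.finite_vertices C),
    ncard_eq_toFinset_card _ (T.boundaryVertices_finite C)]
  simp only [Finset.mem_sdiff, Finite.mem_toFinset] at hx
  refine T.configurationAngle_of_forall_mem fun i hi => ?_
  by_contra hiC
  exact hx.2 ⟨hx.1.1, T.mem_frontier_region.2 ⟨T.mem_region.1 hx.1.2, i, hiC, hi⟩⟩

theorem imbalance_eq_sum {C : Finset ι} (hC : T.IsConfiguration C) :
    T.imbalance C = ∑ i ∈ C, T.tileImbalance i := by
  have h1 : (2 * (T.edges C).ncard : ℝ) =
      ∑ i ∈ C, ((T.tileVertices i).ncard : ℝ) + (T.boundaryVertices C).ncard := by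
    exact_mod_cast T.two_mul_ncard_edges hC
  have h2 : ((T.edges C).ncard : ℝ) + 1 = (T.vertices C).ncard + C.card := by
    exact_mod_cast T.ncard_edges_add_one hC
  simp only [tileImbalance, imbalance, Finset.sum_sub_distrib, ← Finset.sum_mul, Finset.sum_const,
    T.sum_tileVertices_valenceAngle, T.sum_vertices_configurationAngle, nsmul_eq_mul]
  -- The edge number is eliminated: Euler's formula enters with weight `2π`, the double count with
  -- weight `-π`.
  linear_combination -π * h1 + 2 * π * h2

/-- Each summand `angle - π` has absolute value less than `π`; the sum is nonempty, which keeps the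
inequality strict. -/
theorem abs_imbalance_sub_lt {C : Finset ι} (hC : T.IsConfiguration C) :
    |T.imbalance C - 2 * π| < π * (T.boundaryVertices C).ncard := by
  have hf := T.boundaryVertices_finite C
  have h1 : T.imbalance C - 2 * π = ∑ x ∈ hf.toFinset, (T.configurationAngle C x - π) := by
    rw [imbalance, finsum_mem_eq_finite_toFinset_sum _ hf, Finset.sum_sub_distrib,
      Finset.sum_const, nsmul_eq_mul, ncard_eq_toFinset_card _ hf]
    ring
  rw [h1]
  refine (Finset.abs_sum_le_sum_abs _ _).trans_lt ?_
  have h2 : ∑ x ∈ hf.toFinset, |T.configurationAngle C x - π| < ∑ x ∈ hf.toFinset, π := by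
    refine Finset.sum_lt_sum_of_nonempty
      (hf.toFinset_nonempty.2 (T.boundaryVertices_nonempty hC)) fun x hx => ?_
    have := T.configurationAngle_mem_Ioo (hf.mem_toFinset.1 hx).2
    rw [abs_lt]
    constructor <;> linarith [this.1, this.2]
  rwa [Finset.sum_const, nsmul_eq_mul, ← ncard_eq_toFinset_card _ hf, mul_comm] at h2

end Tessellation

end

theorem mainTheorem3 {X : Type*} [TopologicalSpace X] [T2Space X]
    [ChartedSpace (EuclideanSpace ℝ (Fin 2)) X] {ι : Type*} (T : Tessellation X ι)
    (C : Finset ι) (hC : T.IsConfiguration C) :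
    T.imbalance C = ∑ i ∈ C, T.tileImbalance i ∧
      |T.imbalance C - 2 * π| < π * (T.boundaryVertices C).ncard := by
  exact ⟨T.imbalance_eq_sum hC, T.abs_imbalance_sub_lt hC⟩
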